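/- Let $d\ge 1$. For $\mathbf k\in\mathbb Z^d$ write $|\mathbf k|=\max_v|k_v|$ and $\langle\mathbf k\rangle=\max\{1,|\mathbf k|\}$. Let $\mathcal P$ be the set of complex sequences $(a_{\mathbf i})_{\mathbf i\in\mathbb Z^d}$ having period $2^n$ for some $n\ge 0$ (that is, $a_{\mathbf i}=a_{\mathbf j}$ whenever $\mathbf i-\mathbf j\in 2^n\mathbb Z^d$), and let $\mathfrak L$ (the limit-periodic sequences) be the closure of $\mathcal P$ in the norm $\|a\|_\infty=\sup_{\mathbf i}|a_{\mathbf i}|$. For an infinite matrix $A=(a_{\mathbf i,\mathbf j})_{\mathbf i,\mathbf j\in\mathbb Z^d}$ and $r\ge 0$ put $\|A\|_r^2=\sum_{\mathbf k\in\mathbb Z^d}\|A_{\mathbf k}\|_\infty^2\langle\mathbf k\rangle^{2r}$, where $A_{\mathbf k}=(a_{\mathbf i,\mathbf i-\mathbf k})_{\mathbf i\in\mathbb Z^d}$. Fix $\alpha_0>d/2$, $\delta>0$ and $s>\alpha_0+(\log_2 3+\tfrac12)d+12\delta$. Then there is $\epsilon_0=\epsilon_0(s,d,\delta,\alpha_0)>0$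 such that the following holds. Let $\phi=(\phi_{\mathbf i})_{\mathbf i\in\mathbb Z^d}$ be a real sequence with $\phi_{\mathbf 0}=0$ and $|\phi_{\mathbf i}|\le|\mathbf i|^{-s}$ for $\mathbf i\ne\mathbf 0$, let $(T_\phi u)_{\mathbf i}=\sum_{\mathbf j\in\mathbb Z^d}\phi_{\mathbf i-\mathbf j}u_{\mathbf j}$, and suppose that $\|T_\phi\|_{s-d/2-\delta}\le\epsilon_0$. Then there exists a real-valued $d'\in\mathfrak L$ such that $H'=T_\phi+d'_{\mathbf i}\delta_{\mathbf i\mathbf i'}$ is a bounded operator on $\ell^2(\mathbb Z^d)$ which has pure point spectrum with a complete set of polynomially localized eigenfunctions $\{e_{\mathbf k}\}_{\mathbf k\in\mathbb Z^d}$ (their linear span is dense in $\ell^2(\mathbb Z^d)$) satisfying $$|(e_{\mathbf k})_{\mathbf i}|\le 2\langle\mathbf i-\mathbf k\rangle^{-s+(\log_2 3+\frac12)d+12\delta}\qquad\text{for all }\mathbf i,\mathbf k\in\mathbb Z^d.$$ Moreover, $d'$ can be chosen such that in addition the spectrum of $H'$ is $[0,1]$, and it can also be chosen such that in addition the spectrum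 of $H'$ is a Cantor set (a non-empty, compact, perfect, totally disconnected subset of $\mathbb R$) of zero Lebesgue measure. -/

import Mathlib

open MeasureTheory
open scoped ENNReal

noncomputable section

namespace PowerLaw

/-- The lattice `ℤ^d`; its norm `‖k‖` is the maximum of the absolute values of the coordinates. -/
abbrev Site (d : ℕ) : Type := Fin d → ℤ

/-- The Hilbert space `ℓ²(ℤ^d)` of square summable complex sequences. -/
abbrev EllTwo (d : ℕ) : Type := lp (fun _ : Site d => ℂ) 2

/-- `⟨k⟩ = max {1, |k|}`. -/
def bracket {d : ℕ} (k : Site d) : ℝ := max 1 ‖k‖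

/-- The sequences on `ℤ^d` which have period `2 ^ n` for some `n ≥ 0`. -/
def dyadicPeriodic (d : ℕ) : Set (Site d → ℂ) :=
  {a | ∃ n : ℕ, ∀ i j : Site d, (∃ m : Site d, i - j = (2 ^ n : ℤ) • m) → a i = a j}

/-- The limit-periodic sequences: the closure of the dyadic periodic sequences
in the supremum norm. -/
def limitPeriodic (d : ℕ) : Set (Site d → ℂ) :=
  {a | ∀ ε : ℝ, 0 < ε → ∃ p ∈ dyadicPeriodic d, ∀ i : Site d, ‖a i - p i‖ ≤ ε}

/-- The Sobolev norm
`‖A‖_s = (∑_k ‖A_k‖² ⟨k⟩^(2s))^(1/2)` of an infinite matrix `A`, where `A_k` is the `k`-diagonal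
`i ↦ A i (i - k)`, measured in the supremum norm (the norm of the algebra of limit-periodic
sequences). It takes the value `∞` when the series diverges. -/
def sobolevNorm {d : ℕ} (s : ℝ) (A : Matrix (Site d) (Site d) ℂ) : ℝ≥0∞ :=
  (∑' k : Site d, (⨆ i : Site d, ‖A i (i - k)‖ₑ) ^ 2 *
    ENNReal.ofReal (bracket k ^ (2 * s))) ^ (1 / 2 : ℝ)

/-- The matrix of the hopping operator `(T_φ u)_i = ∑_j φ_{i-j} u_j`. -/
def hopping {d : ℕ} (φ : Site d → ℝ) : Matrix (Site d) (Site d) ℂ :=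
  Matrix.of fun i j => (φ (i - j) : ℂ)

/-- The bounded operator `H` on `ℓ²(ℤ^d)` is the one given by the infinite matrix `A`:
`(H u)_i = ∑_j A_{ij} u_j`, with convergent series. At most one `H` has this property. -/
def IsOperatorOf {d : ℕ} (A : Matrix (Site d) (Site d) ℂ)
    (H : EllTwo d →L[ℂ] EllTwo d) : Prop :=
  ∀ (u : EllTwo d) (i : Site d), HasSum (fun j => A i j * u j) (H u i)

/-- Pure point spectrum: the eigenfunctions of `H` are complete, i.e. they span
a dense subspace. -/
def HasPurePointSpectrum {d : ℕ} (H : EllTwo d →L[ℂ] EllTwo d) : Prop :=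
  (Submodule.span ℂ {u : EllTwo d | ∃ μ : ℂ,
    Module.End.HasEigenvector (H : EllTwo d →ₗ[ℂ] EllTwo d) μ u}).topologicalClosure = ⊤

/-- `(e_k)` is a complete family of eigenfunctions of `H`: each `e_k` is an eigenfunction
(in particular non-zero), and together they span a dense subspace. -/
def IsCompleteEigenfamily {d : ℕ} (H : EllTwo d →L[ℂ] EllTwo d)
    (e : Site d → EllTwo d) : Prop :=
  (∀ k, ∃ μ : ℂ, Module.End.HasEigenvector (H : EllTwo d →ₗ[ℂ] EllTwo d) μ (e k)) ∧
    (Submodule.span ℂ (Set.range e)).topologicalClosure = ⊤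

/-- `H` has pure point spectrum with a complete family `(e_k)` of eigenfunctions that are
localized polynomially: `|(e_k)_i| ≤ 2 ⟨i - k⟩^(-r)`. -/
def IsPowerLawLocalized {d : ℕ} (r : ℝ) (H : EllTwo d →L[ℂ] EllTwo d) : Prop :=
  HasPurePointSpectrum H ∧
    ∃ e : Site d → EllTwo d, IsCompleteEigenfamily H e ∧
      ∀ i k : Site d, ‖e k i‖ ≤ 2 * bracket (i - k) ^ (-r)

/-- A Cantor set in the line: non-empty, compact, totally disconnected, without
isolated points. -/
def IsCantorSet (K : Set ℝ) : Prop :=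
  K.Nonempty ∧ IsCompact K ∧ IsTotallyDisconnected K ∧ Perfect K

end PowerLaw

end

noncomputable section

namespace PowerLaw

open Filter Topology

/-! ### Polynomial weights on the lattice -/

section Weights

variable {d : ℕ}

lemma one_le_bracket (k : Site d) : 1 ≤ bracket k := le_max_left _ _

lemma bracket_pos (k : Site d) : 0 < bracket k := one_pos.trans_le (one_le_bracket k)

lemma norm_le_bracket (k : Site d) : ‖k‖ ≤ bracket k := le_max_right _ _

@[simp] lemma bracket_zero : bracket (0 : Site d) = 1 := by simp [bracket]

@[simp] lemma bracket_neg (k : Site d) : bracket (-k) = bracket k := by simp [bracket]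

lemma one_le_norm_of_ne_zero {k : Site d} (hk : k ≠ 0) : 1 ≤ ‖k‖ := by
  obtain ⟨v, hv⟩ := Function.ne_iff.mp hk
  have h1 : (1 : ℝ) ≤ |(k v : ℝ)| := by exact_mod_cast Int.one_le_abs hv
  have h2 := norm_le_pi_norm k v
  rw [Int.norm_eq_abs] at h2
  exact h1.trans h2

lemma bracket_eq_norm {k : Site d} (hk : k ≠ 0) : bracket k = ‖k‖ :=
  max_eq_right (one_le_norm_of_ne_zero hk)

lemma bracket_rpow_le_rpow (k : Site d) {a b : ℝ} (h : a ≤ b) : bracket k ^ a ≤ bracket k ^ b :=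
  Real.rpow_le_rpow_of_exponent_le (one_le_bracket k) h

lemma summable_bracket_rpow {σ : ℝ} (hσ : (d : ℝ) < σ) :
    Summable fun k : Site d => bracket k ^ (-σ) := by
  let b := Pi.basisFun ℝ (Fin d)
  let L : Submodule ℤ (Fin d → ℝ) := Submodule.span ℤ (Set.range b)
  have hrank : Module.finrank ℤ L = d := by
    rw [ZLattice.rank ℝ L]; simp
  have hs := ZLattice.summable_norm_rpow L (-σ) (by rw [hrank]; linarith)
  have hmem : ∀ k : Site d, (fun v => (k v : ℝ)) ∈ L := by
    intro k
    rw [b.mem_span_iff_repr_mem ℤ]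
    intro v
    exact ⟨k v, by simp [b]⟩
  let f : Site d → L := fun k => ⟨fun v => (k v : ℝ), hmem k⟩
  have hf : Function.Injective f := by
    intro x y hxy
    ext v
    have := congrFun (congrArg Subtype.val hxy) v
    simpa [f] using this
  have hn : ∀ k : Site d, ‖f k‖ = ‖k‖ := by
    intro k
    change ‖(fun v => (k v : ℝ))‖ = ‖k‖
    simp only [Pi.norm_def]
    congr 2
  have hs' := hs.comp_injective hf
  have hsum : Summable fun k : Site d => ‖k‖ ^ (-σ) := by
    refine hs'.congr fun k => ?_
    change ‖f k‖ ^ (-σ) = _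
    rw [hn]
  refine hsum.of_norm_bounded_eventually ?_
  rw [Filter.eventually_cofinite]
  refine (Set.finite_singleton (0 : Site d)).subset ?_
  intro k hk
  by_contra hk0
  apply hk
  rw [bracket_eq_norm (by simpa using hk0), Real.norm_of_nonneg (by positivity)]

lemma norm_le_norm_add_norm_sub (k j : Site d) : ‖k‖ ≤ ‖j‖ + ‖k - j‖ := by
  simpa using norm_add_le j (k - j)

lemma bracket_rpow_le_add {σ : ℝ} (hσ : 0 ≤ σ) (k j : Site d) :
    bracket k ^ σ ≤ 2 ^ σ * (bracket j ^ σ + bracket (k - j) ^ σ) := by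
  have h : bracket k ≤ 2 * max (bracket j) (bracket (k - j)) := by
    have h1 := norm_le_norm_add_norm_sub k j
    have h2 := (norm_le_bracket j).trans (le_max_left (bracket j) (bracket (k - j)))
    have h3 := (norm_le_bracket (k - j)).trans (le_max_right (bracket j) (bracket (k - j)))
    have h4 := (one_le_bracket j).trans (le_max_left (bracket j) (bracket (k - j)))
    exact max_le (by linarith) (by linarith)
  have hj := bracket_pos j
  have hkj := bracket_pos (k - j)
  calc bracket k ^ σ ≤ (2 * max (bracket j) (bracket (k - j))) ^ σ :=
        Real.rpow_le_rpow (bracket_pos k).le h hσ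
    _ = 2 ^ σ * max (bracket j) (bracket (k - j)) ^ σ := by
        rw [Real.mul_rpow (by norm_num) (by positivity)]
    _ ≤ _ := by
        gcongr
        rcases max_choice (bracket j) (bracket (k - j)) with h | h <;> rw [h]
        · have : 0 ≤ bracket (k - j) ^ σ := by positivity
          linarith
        · have : 0 ≤ bracket j ^ σ := by positivity
          linarith

end Weights

/-! ### Convolution kernels -/

/-- A summable kernel on `ℤ^d` which dominates its own convolution square. -/
structure IsKernel {d : ℕ} (g : Site d → ℝ) : Prop where
  nonneg : ∀ k, 0 ≤ g k
  summable : Summable g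
  tsum_le_one : ∑' k, g k ≤ 1
  conv_le : ∀ k, ∑' j, g j * g (k - j) ≤ g k

namespace IsKernel

variable {d : ℕ} {g : Site d → ℝ}

lemma le_one (hg : IsKernel g) (k : Site d) : g k ≤ 1 :=
  (hg.summable.le_tsum k fun j _ => hg.nonneg j).trans hg.tsum_le_one

lemma summable_conv (hg : IsKernel g) (k : Site d) : Summable fun j => g j * g (k - j) :=
  hg.summable.of_nonneg_of_le (fun _ => mul_nonneg (hg.nonneg _) (hg.nonneg _))
    fun _ => mul_le_of_le_one_right (hg.nonneg _) (hg.le_one _)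

end IsKernel

section Kernels

variable {d : ℕ}

/-- The normalizing constant of the kernels `⟨k⟩^(-σ) e^(-ρ|k|)`. -/
def kernelConst (d : ℕ) (σ : ℝ) : ℝ :=
  max 1 (2 ^ (σ + 1) * ∑' k : Site d, bracket k ^ (-σ))

/-- The kernel `⟨k⟩^(-σ) e^(-ρ|k|)`, normalized. -/
def kernel (σ ρ : ℝ) (k : Site d) : ℝ :=
  bracket k ^ (-σ) * Real.exp (-(ρ * ‖k‖)) / kernelConst d σ

lemma one_le_kernelConst (d : ℕ) (σ : ℝ) : 1 ≤ kernelConst d σ := le_max_left _ _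

lemma kernelConst_pos (d : ℕ) (σ : ℝ) : 0 < kernelConst d σ :=
  one_pos.trans_le (one_le_kernelConst d σ)

lemma kernel_pos (σ ρ : ℝ) (k : Site d) : 0 < kernel σ ρ k := by
  have := bracket_pos k
  have := kernelConst_pos d σ
  unfold kernel
  positivity

lemma kernel_anti (σ : ℝ) {ρ ρ' : ℝ} (h : ρ ≤ ρ') (k : Site d) : kernel σ ρ' k ≤ kernel σ ρ k := by
  have := bracket_pos k
  have := kernelConst_pos d σ
  unfold kernel
  gcongr

lemma isKernel_kernel {σ ρ : ℝ} (hσ : (d : ℝ) < σ) (hρ : 0 ≤ ρ) :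
    IsKernel (kernel σ ρ : Site d → ℝ) := by
  have hσ0 : 0 ≤ σ := (Nat.cast_nonneg d).trans hσ.le
  set K := kernelConst d σ with hK
  have hK0 : 0 < K := kernelConst_pos d σ
  have hsum := summable_bracket_rpow (d := d) hσ
  set S := ∑' k : Site d, bracket k ^ (-σ) with hS
  have hS0 : 0 ≤ S := tsum_nonneg fun k => Real.rpow_nonneg (bracket_pos k).le _
  have hSK : 2 ^ (σ + 1) * S ≤ K := le_max_right _ _
  have h2 : (1 : ℝ) ≤ 2 ^ (σ + 1) := Real.one_le_rpow (by norm_num) (by linarith)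
  have hle : ∀ k : Site d, kernel σ ρ k ≤ bracket k ^ (-σ) / K := by
    intro k
    have := bracket_pos k
    unfold kernel
    rw [← hK]
    gcongr
    refine mul_le_of_le_one_right (by positivity) (Real.exp_le_one_iff.mpr ?_)
    have : 0 ≤ ρ * ‖k‖ := by positivity
    linarith
  have hs1 : Summable fun k : Site d => bracket k ^ (-σ) / K := hsum.div_const K
  have hsk : Summable (kernel σ ρ : Site d → ℝ) :=
    hs1.of_nonneg_of_le (fun k => (kernel_pos σ ρ k).le) hle
  refine ⟨fun k => (kernel_pos σ ρ k).le, hsk, ?_, ?_⟩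
  · calc ∑' k : Site d, kernel σ ρ k ≤ ∑' k : Site d, bracket k ^ (-σ) / K := hsk.tsum_le_tsum hle hs1
      _ = S / K := tsum_div_const
      _ ≤ 1 := by
        rw [div_le_one hK0]
        nlinarith
  · intro k
    have hpt : ∀ j : Site d, kernel σ ρ j * kernel σ ρ (k - j) ≤
        2 ^ σ * kernel σ ρ k / K * (bracket j ^ (-σ) + bracket (k - j) ^ (-σ)) := by
      intro j
      have hbk := bracket_pos k
      have hbj := bracket_pos j
      have hbkj := bracket_pos (k - j)
      have hexp : Real.exp (-(ρ * ‖j‖)) * Real.exp (-(ρ * ‖k - j‖)) ≤ Real.exp (-(ρ * ‖k‖)) := by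
        rw [← Real.exp_add]
        apply Real.exp_le_exp.mpr
        have := mul_le_mul_of_nonneg_left (norm_le_norm_add_norm_sub k j) hρ
        linarith
      have hpol : bracket j ^ (-σ) * bracket (k - j) ^ (-σ) ≤
          2 ^ σ * bracket k ^ (-σ) * (bracket j ^ (-σ) + bracket (k - j) ^ (-σ)) := by
        have h := bracket_rpow_le_add hσ0 k j
        rw [Real.rpow_neg hbj.le, Real.rpow_neg hbkj.le, Real.rpow_neg hbk.le]
        have e1 : 0 < bracket k ^ σ := by positivity
        have e2 : 0 < bracket j ^ σ := by positivity
        have e3 : 0 < bracket (k - j) ^ σ := by positivity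
        have : 2 ^ σ * (bracket k ^ σ)⁻¹ * ((bracket j ^ σ)⁻¹ + (bracket (k - j) ^ σ)⁻¹) =
            (2 ^ σ * (bracket j ^ σ + bracket (k - j) ^ σ)) / bracket k ^ σ *
              ((bracket j ^ σ)⁻¹ * (bracket (k - j) ^ σ)⁻¹) := by
          field_simp
          ring
        rw [this]
        refine le_mul_of_one_le_left (by positivity) ?_
        rwa [one_le_div e1]
      have e : kernel σ ρ j * kernel σ ρ (k - j) =
          (bracket j ^ (-σ) * bracket (k - j) ^ (-σ)) *
            (Real.exp (-(ρ * ‖j‖)) * Real.exp (-(ρ * ‖k - j‖))) / (K * K) := by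
        unfold kernel
        rw [← hK]
        field_simp
      rw [e]
      calc _ ≤ (2 ^ σ * bracket k ^ (-σ) * (bracket j ^ (-σ) + bracket (k - j) ^ (-σ))) *
            Real.exp (-(ρ * ‖k‖)) / (K * K) := by gcongr
        _ = _ := by
            unfold kernel
            rw [← hK]
            field_simp
    have hsh : Summable fun j : Site d => bracket (k - j) ^ (-σ) :=
      (Equiv.subLeft k).summable_iff.mpr hsum
    have hshS : ∑' j : Site d, bracket (k - j) ^ (-σ) = S :=
      (Equiv.subLeft k).tsum_eq fun j : Site d => bracket j ^ (-σ)
    have hsb := (hsum.add hsh).mul_left (2 ^ σ * kernel σ ρ k / K)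
    have hconv : Summable fun j : Site d => kernel σ ρ j * kernel σ ρ (k - j) :=
      hsb.of_nonneg_of_le
        (fun j => mul_nonneg (kernel_pos σ ρ j).le (kernel_pos σ ρ (k - j)).le) hpt
    calc ∑' j : Site d, kernel σ ρ j * kernel σ ρ (k - j)
        ≤ ∑' j : Site d, 2 ^ σ * kernel σ ρ k / K *
          (bracket j ^ (-σ) + bracket (k - j) ^ (-σ)) := hconv.tsum_le_tsum hpt hsb
      _ = kernel σ ρ k * ((2 ^ (σ + 1) * S) / K) := by
          rw [tsum_mul_left, hsum.tsum_add hsh, hshS, ← hS, Real.rpow_add_one (by norm_num)]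
          field_simp
          ring
      _ ≤ kernel σ ρ k * 1 := by
          have := (kernel_pos σ ρ k).le
          gcongr
          rwa [div_le_one hK0]
      _ = kernel σ ρ k := mul_one _

/-- Halving the exponential rate absorbs a polynomial factor. -/
lemma exists_rpow_mul_exp_le {b : ℝ} (hb : 0 ≤ b) :
    ∃ C : ℝ, 1 ≤ C ∧ ∀ (d : ℕ) (k : Site d) (n : ℕ),
      bracket k ^ b * Real.exp (-((2 : ℝ)⁻¹ ^ (n + 1) * ‖k‖)) ≤ C * ((2 : ℝ) ^ b) ^ n := by
  obtain ⟨C, hC1, hC⟩ : ∃ C : ℝ, 1 ≤ C ∧ ∀ x : ℝ, 0 ≤ x → x ^ b * Real.exp (-x) ≤ C := by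
    obtain ⟨m, hm⟩ := exists_nat_ge b
    refine ⟨max 1 (m.factorial : ℝ), le_max_left _ _, fun x hx => ?_⟩
    rcases le_total x 1 with h | h
    · have h1 : x ^ b ≤ 1 := Real.rpow_le_one hx h hb
      have h2 : Real.exp (-x) ≤ 1 := Real.exp_le_one_iff.mpr (by linarith)
      exact (mul_le_one₀ h1 (Real.exp_pos _).le h2).trans (le_max_left _ _)
    · have h1 : x ^ b ≤ x ^ m := by
        rw [← Real.rpow_natCast]
        exact Real.rpow_le_rpow_of_exponent_le h hm
      have h2 := Real.pow_div_factorial_le_exp x hx m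
      rw [div_le_iff₀ (by positivity)] at h2
      calc x ^ b * Real.exp (-x) ≤ (Real.exp x * m.factorial) * Real.exp (-x) := by
            gcongr
            exact h1.trans h2
        _ = m.factorial := by
            rw [mul_right_comm, ← Real.exp_add]
            simp
        _ ≤ _ := le_max_right _ _
  refine ⟨C * 2 ^ b, ?_, fun d k n => ?_⟩
  · have : (1 : ℝ) ≤ 2 ^ b := Real.one_le_rpow (by norm_num) hb
    nlinarith
  have hp : (1 : ℝ) ≤ ((2 : ℝ) ^ b) ^ n := one_le_pow₀ (Real.one_le_rpow (by norm_num) hb)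
  have h2b : (1 : ℝ) ≤ 2 ^ b := Real.one_le_rpow (by norm_num) hb
  by_cases hk : k = 0
  · subst hk
    simp only [bracket_zero, Real.one_rpow, norm_zero, mul_zero, neg_zero, Real.exp_zero, mul_one]
    nlinarith [mul_le_mul hC1 h2b zero_le_one (by linarith)]
  · rw [bracket_eq_norm hk]
    have hx : (0 : ℝ) ≤ (2 : ℝ)⁻¹ ^ (n + 1) * ‖k‖ := by positivity
    have h := hC _ hx
    rw [Real.mul_rpow (by positivity) (norm_nonneg k)] at h
    have e : (((2 : ℝ)⁻¹ ^ (n + 1)) ^ b) * ((2 : ℝ) ^ b * ((2 : ℝ) ^ b) ^ n) = 1 := by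
      rw [← pow_succ', ← Real.rpow_natCast, ← Real.rpow_natCast, ← Real.rpow_mul (by norm_num),
        ← Real.rpow_mul (by norm_num), Real.inv_rpow (by norm_num), mul_comm b]
      exact inv_mul_cancel₀ (by positivity)
    calc ‖k‖ ^ b * Real.exp (-((2 : ℝ)⁻¹ ^ (n + 1) * ‖k‖))
        = (((2 : ℝ)⁻¹ ^ (n + 1)) ^ b * ‖k‖ ^ b * Real.exp (-((2 : ℝ)⁻¹ ^ (n + 1) * ‖k‖))) *
          ((2 : ℝ) ^ b * ((2 : ℝ) ^ b) ^ n) := by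
          linear_combination (-(‖k‖ ^ b * Real.exp (-((2 : ℝ)⁻¹ ^ (n + 1) * ‖k‖)))) * e
      _ ≤ C * ((2 : ℝ) ^ b * ((2 : ℝ) ^ b) ^ n) := by gcongr
      _ = _ := by ring

end Kernels

/-! ### Bounded operators and their matrices -/

section Operators

variable {𝕜 : Type*} [RCLike 𝕜] {d : ℕ}

/-- The space `ℓ²(ℤ^d)` over `𝕜`. -/
abbrev L2 (𝕜 : Type*) [RCLike 𝕜] (d : ℕ) : Type _ := lp (fun _ : Site d => 𝕜) 2

/-- The unit vectors of `ℓ²(ℤ^d)`. -/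
def unitVec (𝕜 : Type*) [RCLike 𝕜] {d : ℕ} (j : Site d) : L2 𝕜 d := lp.single 2 j 1

lemma unitVec_apply (i j : Site d) : unitVec 𝕜 j i = if i = j then 1 else 0 := by
  simp [unitVec, lp.single_apply, Pi.single_apply]

lemma norm_unitVec (j : Site d) : ‖unitVec 𝕜 j‖ = 1 := by
  simp [unitVec, lp.norm_single]

/-- The matrix entries of a bounded operator. -/
def entry (A : L2 𝕜 d →L[𝕜] L2 𝕜 d) (i j : Site d) : 𝕜 := A (unitVec 𝕜 j) i

lemma hasSum_unitVec (u : L2 𝕜 d) : HasSum (fun j => u j • unitVec 𝕜 j) u := by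
  have h := lp.hasSum_single (p := 2) (by simp) u
  refine h.congr_fun ?_
  intro j
  simp [unitVec, ← lp.single_smul]

lemma hasSum_entry (A : L2 𝕜 d →L[𝕜] L2 𝕜 d) (u : L2 𝕜 d) (i : Site d) :
    HasSum (fun j => entry A i j * u j) (A u i) := by
  have h := ((lp.evalCLM 𝕜 (fun _ : Site d => 𝕜) 2 i).comp A).hasSum (hasSum_unitVec u)
  refine h.congr_fun ?_
  intro j
  rw [mul_comm]
  simp only [map_smul, smul_eq_mul]
  rfl

lemma hasSum_entry_mul (A B : L2 𝕜 d →L[𝕜] L2 𝕜 d) (i k : Site d) :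
    HasSum (fun j => entry A i j * entry B j k) (entry (A * B) i k) :=
  hasSum_entry A (B (unitVec 𝕜 k)) i

lemma operator_ext {A B : L2 𝕜 d →L[𝕜] L2 𝕜 d} (h : ∀ i j, entry A i j = entry B i j) :
    A = B := by
  ext u i
  refine (hasSum_entry A u i).unique ?_
  simp_rw [h]
  exact hasSum_entry B u i

@[simp] lemma entry_add (A B : L2 𝕜 d →L[𝕜] L2 𝕜 d) (i j : Site d) :
    entry (A + B) i j = entry A i j + entry B i j := by simp [entry]

@[simp] lemma entry_sub (A B : L2 𝕜 d →L[𝕜] L2 𝕜 d) (i j : Site d) :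
    entry (A - B) i j = entry A i j - entry B i j := by simp [entry]

@[simp] lemma entry_neg (A : L2 𝕜 d →L[𝕜] L2 𝕜 d) (i j : Site d) :
    entry (-A) i j = -entry A i j := by simp [entry]

@[simp] lemma entry_zero (i j : Site d) : entry (0 : L2 𝕜 d →L[𝕜] L2 𝕜 d) i j = 0 := by
  simp [entry]

@[simp] lemma entry_one (i j : Site d) :
    entry (1 : L2 𝕜 d →L[𝕜] L2 𝕜 d) i j = if i = j then 1 else 0 := by
  simp [entry, unitVec_apply]

lemma norm_entry_le (A : L2 𝕜 d →L[𝕜] L2 𝕜 d) (i j : Site d) : ‖entry A i j‖ ≤ ‖A‖ := by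
  calc ‖entry A i j‖ ≤ ‖A (unitVec 𝕜 j)‖ := lp.norm_apply_le_norm (by simp) _ _
    _ ≤ ‖A‖ * ‖unitVec 𝕜 j‖ := A.le_opNorm _
    _ = ‖A‖ := by rw [norm_unitVec, mul_one]

/-- A bounded weighted shift. -/
lemma exists_weightedShift (b : Site d → 𝕜) {C : ℝ} (hb : ∀ i, ‖b i‖ ≤ C)
    (k : Site d) : ∃ B : L2 𝕜 d →L[𝕜] L2 𝕜 d,
      (∀ u i, B u i = b i * u (i - k)) ∧ ‖B‖ ≤ C := by
  have hC : 0 ≤ C := (norm_nonneg _).trans (hb 0)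
  have h2 : (0 : ℝ) < (2 : ℝ≥0∞).toReal := by norm_num
  have key : ∀ (u : L2 𝕜 d) (s : Finset (Site d)),
      ∑ i ∈ s, ‖b i * u (i - k)‖ ^ (2 : ℝ≥0∞).toReal ≤ (C * ‖u‖) ^ (2 : ℝ≥0∞).toReal := by
    intro u s
    calc ∑ i ∈ s, ‖b i * u (i - k)‖ ^ (2 : ℝ≥0∞).toReal
        ≤ ∑ i ∈ s, C ^ (2 : ℝ≥0∞).toReal * ‖u (i - k)‖ ^ (2 : ℝ≥0∞).toReal := by
          gcongr with i _
          rw [norm_mul, ← Real.mul_rpow hC (norm_nonneg _)]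
          gcongr
          exact hb i
      _ = C ^ (2 : ℝ≥0∞).toReal *
          ∑ i ∈ s.map (Equiv.subRight k).toEmbedding, ‖u i‖ ^ (2 : ℝ≥0∞).toReal := by
          rw [← Finset.mul_sum, Finset.sum_map]
          rfl
      _ ≤ C ^ (2 : ℝ≥0∞).toReal * ‖u‖ ^ (2 : ℝ≥0∞).toReal := by
          gcongr
          exact lp.sum_rpow_le_norm_rpow h2 u _
      _ = _ := (Real.mul_rpow hC (norm_nonneg _)).symm
  let L : L2 𝕜 d →ₗ[𝕜] L2 𝕜 d :=
    { toFun := fun u => ⟨fun i => b i * u (i - k), memℓp_gen' (key u)⟩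
      map_add' := by
        intro u v
        ext i
        change b i * (u + v) (i - k) = b i * u (i - k) + b i * v (i - k)
        simp [mul_add]
      map_smul' := by
        intro c u
        ext i
        change b i * (c • u) (i - k) = c * (b i * u (i - k))
        simp [mul_left_comm] }
  refine ⟨L.mkContinuous C fun u => ?_, fun u i => rfl, LinearMap.mkContinuous_norm_le _ hC _⟩
  exact lp.norm_le_of_forall_sum_le h2 (by positivity) (key u)

lemma exists_operator (a : Site d → Site d → 𝕜) {h : Site d → ℝ} (hs : Summable h)
    (ha : ∀ i j, ‖a i j‖ ≤ h (i - j)) : ∃ A : L2 𝕜 d →L[𝕜] L2 𝕜 d,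
      (∀ i j, entry A i j = a i j) ∧ ‖A‖ ≤ ∑' k, h k := by
  have hex : ∀ k, ∃ B : L2 𝕜 d →L[𝕜] L2 𝕜 d,
      (∀ u i, B u i = a i (i - k) * u (i - k)) ∧ ‖B‖ ≤ h k := fun k =>
    exists_weightedShift (fun i => a i (i - k)) (fun i => by simpa using ha i (i - k)) k
  choose B hB hBn using hex
  have hBs : Summable B := hs.of_norm_bounded hBn
  refine ⟨∑' k, B k, fun i j => ?_, tsum_of_norm_bounded hs.hasSum hBn⟩
  have h1 : HasSum (fun k => entry (B k) i j) (entry (∑' k, B k) i j) := by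
    have := ((lp.evalCLM 𝕜 (fun _ : Site d => 𝕜) 2 i).comp
      (ContinuousLinearMap.apply 𝕜 (L2 𝕜 d) (unitVec 𝕜 j))).hasSum hBs.hasSum
    exact this
  have h2 : HasSum (fun k => entry (B k) i j) (a i j) := by
    have := hasSum_ite_eq (i - j) (a i j)
    refine this.congr_fun ?_
    intro k
    simp only [entry, hB, unitVec_apply]
    by_cases hk : k = i - j
    · subst hk; simp
    · rw [if_neg hk, if_neg, mul_zero]
      intro h; apply hk; rw [← h]; abel
  exact h1.unique h2

/-- The bounded operator with a given matrix (and `0` if there is none). -/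
def ofEntries (a : Site d → Site d → 𝕜) : L2 𝕜 d →L[𝕜] L2 𝕜 d :=
  open Classical in
  if h : ∃ A : L2 𝕜 d →L[𝕜] L2 𝕜 d, ∀ i j, entry A i j = a i j then h.choose else 0

lemma entry_ofEntries {a : Site d → Site d → 𝕜} {h : Site d → ℝ} (hs : Summable h)
    (ha : ∀ i j, ‖a i j‖ ≤ h (i - j)) (i j : Site d) : entry (ofEntries a) i j = a i j := by
  obtain ⟨A, hA, -⟩ := exists_operator a hs ha
  have hex : ∃ A : L2 𝕜 d →L[𝕜] L2 𝕜 d, ∀ i j, entry A i j = a i j := ⟨A, hA⟩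
  rw [ofEntries, dif_pos hex]
  exact hex.choose_spec i j

lemma norm_le_tsum_of_entry_le {A : L2 𝕜 d →L[𝕜] L2 𝕜 d} {h : Site d → ℝ} (hs : Summable h)
    (ha : ∀ i j, ‖entry A i j‖ ≤ h (i - j)) : ‖A‖ ≤ ∑' k, h k := by
  obtain ⟨B, hB, hn⟩ := exists_operator (entry A) hs ha
  rwa [operator_ext (A := A) (B := B) fun i j => (hB i j).symm]

/-- The multiplication operator by a sequence. -/
def diagOp (q : Site d → 𝕜) : L2 𝕜 d →L[𝕜] L2 𝕜 d :=
  ofEntries fun i j => if i = j then q i else 0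

lemma summable_dirac (C : ℝ) : Summable fun k : Site d => if k = 0 then C else 0 :=
  (hasSum_ite_eq 0 C).summable

lemma norm_ite_le_dirac {q : Site d → 𝕜} {C : ℝ} (hq : ∀ i, ‖q i‖ ≤ C) (i j : Site d) :
    ‖if i = j then q i else 0‖ ≤ if i - j = 0 then C else 0 := by
  simp only [sub_eq_zero]
  split_ifs
  · exact hq i
  · simp

lemma entry_diagOp {q : Site d → 𝕜} {C : ℝ} (hq : ∀ i, ‖q i‖ ≤ C) (i j : Site d) :
    entry (diagOp q) i j = if i = j then q i else 0 :=
  entry_ofEntries (summable_dirac C) (norm_ite_le_dirac hq) i j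

lemma diagOp_apply {q : Site d → 𝕜} {C : ℝ} (hq : ∀ i, ‖q i‖ ≤ C) (u : L2 𝕜 d) (i : Site d) :
    diagOp q u i = q i * u i := by
  refine (hasSum_entry (diagOp q) u i).unique ?_
  have := hasSum_ite_eq i (q i * u i)
  refine this.congr_fun ?_
  intro j
  rw [entry_diagOp hq]
  by_cases h : j = i
  · subst h; simp
  · simp [h, Ne.symm h]

lemma entry_diagOp_mul {q : Site d → 𝕜} {C : ℝ} (hq : ∀ i, ‖q i‖ ≤ C)
    (A : L2 𝕜 d →L[𝕜] L2 𝕜 d) (i j : Site d) :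
    entry (diagOp q * A) i j = q i * entry A i j :=
  diagOp_apply hq _ i

lemma entry_mul_diagOp {q : Site d → 𝕜} {C : ℝ} (hq : ∀ i, ‖q i‖ ≤ C)
    (A : L2 𝕜 d →L[𝕜] L2 𝕜 d) (i j : Site d) :
    entry (A * diagOp q) i j = entry A i j * q j := by
  refine (hasSum_entry_mul A (diagOp q) i j).unique ?_
  have := hasSum_ite_eq j (entry A i j * q j)
  refine this.congr_fun ?_
  intro k
  rw [entry_diagOp hq]
  by_cases h : k = j
  · subst h; simp
  · simp [h]

end Operators

/-! ### Operators dominated by a kernel -/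

section Dominated

variable {d : ℕ}

/-- The matrix entries of `A` are dominated by the convolution kernel `M g`. -/
def Dominated (g : Site d → ℝ) (M : ℝ) (A : L2 ℝ d →L[ℝ] L2 ℝ d) : Prop :=
  ∀ i j, |entry A i j| ≤ M * g (i - j)

namespace Dominated

variable {g g' : Site d → ℝ} {M M' : ℝ} {A B : L2 ℝ d →L[ℝ] L2 ℝ d}

lemma mono (h : Dominated g M A) (hM : 0 ≤ M') (hMM : M ≤ M') (hg : ∀ k, 0 ≤ g k)
    (hgg : ∀ k, g k ≤ g' k) : Dominated g' M' A := fun i j =>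
  (h i j).trans ((mul_le_mul_of_nonneg_right hMM (hg _)).trans
    (mul_le_mul_of_nonneg_left (hgg _) hM))

lemma add (hA : Dominated g M A) (hB : Dominated g M' B) : Dominated g (M + M') (A + B) :=
  fun i j => by
    rw [entry_add, add_mul]
    exact (abs_add_le _ _).trans (add_le_add (hA i j) (hB i j))

lemma neg (hA : Dominated g M A) : Dominated g M (-A) := fun i j => by
  rw [entry_neg, abs_neg]
  exact hA i j

lemma sub (hA : Dominated g M A) (hB : Dominated g M' B) : Dominated g (M + M') (A - B) := by
  rw [sub_eq_add_neg]
  exact hA.add hB.neg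

lemma _root_.PowerLaw.hasSum_entry_mul_sub (A B : L2 ℝ d →L[ℝ] L2 ℝ d) (i k : Site d) :
    HasSum (fun l => entry A i (i - l) * entry B (i - l) k) (entry (A * B) i k) := by
  have h := hasSum_entry_mul A B i k
  rw [← (Equiv.subLeft i).hasSum_iff] at h
  exact h

lemma mul (hg : IsKernel g) (hM : 0 ≤ M) (hM' : 0 ≤ M') (hA : Dominated g M A)
    (hB : Dominated g M' B) : Dominated g (M * M') (A * B) := by
  intro i k
  have hs : HasSum (fun l => entry A i (i - l) * entry B (i - l) k) (entry (A * B) i k) :=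
    hasSum_entry_mul_sub A B i k
  have hb : Summable fun l => M * M' * (g l * g (i - k - l)) :=
    (hg.summable_conv (i - k)).mul_left _
  have hle : ∀ l, ‖entry A i (i - l) * entry B (i - l) k‖ ≤ M * M' * (g l * g (i - k - l)) := by
    intro l
    have h1 := hA i (i - l)
    have h2 := hB (i - l) k
    rw [sub_sub_cancel] at h1
    rw [show i - l - k = i - k - l by abel] at h2
    rw [Real.norm_eq_abs, abs_mul]
    calc _ ≤ (M * g l) * (M' * g (i - k - l)) :=
          mul_le_mul h1 h2 (abs_nonneg _) (mul_nonneg hM (hg.nonneg _))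
      _ = _ := by ring
  have h := tsum_of_norm_bounded hb.hasSum hle
  rw [hs.tsum_eq, tsum_mul_left, Real.norm_eq_abs] at h
  exact h.trans (mul_le_mul_of_nonneg_left (hg.conv_le _) (mul_nonneg hM hM'))

lemma norm_le (hg : IsKernel g) (hM : 0 ≤ M) (hA : Dominated g M A) : ‖A‖ ≤ M := by
  have h := norm_le_tsum_of_entry_le (A := A) (hg.summable.mul_left M) hA
  rw [tsum_mul_left] at h
  exact h.trans (mul_le_of_le_one_right hM hg.tsum_le_one)

/-- A diagonal operator is dominated by every kernel. -/
lemma of_diagonal {C : ℝ} (hg0 : 0 < g 0) (hg : ∀ k, 0 ≤ g k) (hC : 0 ≤ C)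
    (hoff : ∀ i j, i ≠ j → entry A i j = 0)
    (hdiag : ∀ i, |entry A i i| ≤ C) : Dominated g (C / g 0) A := by
  intro i j
  by_cases h : i = j
  · subst h
    rw [sub_self, div_mul_cancel₀ _ hg0.ne']
    exact hdiag i
  · rw [hoff i j h, abs_zero]
    exact mul_nonneg (div_nonneg hC hg0.le) (hg _)

end Dominated

/-- The diagonal part of an operator. -/
def diagPart (A : L2 ℝ d →L[ℝ] L2 ℝ d) : L2 ℝ d →L[ℝ] L2 ℝ d :=
  diagOp fun i => entry A i i

lemma entry_diagPart (A : L2 ℝ d →L[ℝ] L2 ℝ d) (i j : Site d) :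
    entry (diagPart A) i j = if i = j then entry A i i else 0 :=
  entry_diagOp (fun i => norm_entry_le A i i) i j

lemma Dominated.diagPart {g : Site d → ℝ} {M : ℝ} {A : L2 ℝ d →L[ℝ] L2 ℝ d}
    (hA : Dominated g M A) : Dominated g M (diagPart A) := by
  intro i j
  rw [entry_diagPart]
  split_ifs with h
  · subst h
    exact hA i i
  · rw [abs_zero]
    exact (abs_nonneg _).trans (hA i j)

lemma Dominated.sub_diagPart {g : Site d → ℝ} {M : ℝ} {A : L2 ℝ d →L[ℝ] L2 ℝ d}
    (hA : Dominated g M A) : Dominated g M (A - PowerLaw.diagPart A) := by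
  intro i j
  rw [entry_sub, entry_diagPart]
  split_ifs with h
  · subst h
    rw [sub_self, abs_zero]
    exact (abs_nonneg _).trans (hA i i)
  · rw [sub_zero]
    exact hA i j

end Dominated

/-! ### Limit-periodic sequences and matrices -/

section LimitPeriodic

variable {d : ℕ}

/-- The filter of pairs `(t, i)` along which `t` tends to `0` dyadically, uniformly in `i`. -/
def translationFilter (d : ℕ) : Filter (Site d × Site d) :=
  ⨅ n : ℕ, 𝓟 {p | ∃ m : Site d, p.1 = (2 ^ n : ℤ) • m}

/-- Uniform almost invariance under dyadic translations. -/
def AlmostPeriodic (a : Site d → ℝ) : Prop :=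
  Tendsto (fun p : Site d × Site d => a (p.2 + p.1) - a p.2) (translationFilter d) (𝓝 0)

lemma hasBasis_translationFilter : (translationFilter d).HasBasis (fun _ : ℕ => True)
    fun n => {p | ∃ m : Site d, p.1 = (2 ^ n : ℤ) • m} := by
  refine hasBasis_iInf_principal (directed_of_isDirected_le ?_)
  rintro a b hab ⟨t, i⟩ ⟨m, hm⟩
  refine ⟨(2 ^ (b - a) : ℤ) • m, ?_⟩
  rw [smul_smul, ← pow_add, Nat.add_sub_cancel' hab]
  exact hm

lemma almostPeriodic_iff {a : Site d → ℝ} : AlmostPeriodic a ↔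
    ∀ ε : ℝ, 0 < ε → ∃ n : ℕ, ∀ m i : Site d, |a (i + (2 ^ n : ℤ) • m) - a i| < ε := by
  unfold AlmostPeriodic
  rw [hasBasis_translationFilter.tendsto_iff Metric.nhds_basis_ball]
  refine forall₂_congr fun ε hε => exists_congr fun n => ?_
  simp only [true_and, Set.mem_ofPred_eq, Metric.mem_ball, dist_zero_right, Real.norm_eq_abs]
  constructor
  · intro h m i
    exact h (_, i) ⟨m, rfl⟩
  · rintro h ⟨t, i⟩ ⟨m, hm⟩
    simp only at hm
    subst hm
    exact h m i

namespace AlmostPeriodic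

variable {a b : Site d → ℝ}

lemma const (c : ℝ) : AlmostPeriodic fun _ : Site d => c := by
  simp only [AlmostPeriodic, sub_self]
  exact tendsto_const_nhds

lemma add (ha : AlmostPeriodic a) (hb : AlmostPeriodic b) : AlmostPeriodic fun i => a i + b i := by
  have h := Tendsto.add ha hb
  rw [add_zero] at h
  exact h.congr fun p => by ring

lemma neg (ha : AlmostPeriodic a) : AlmostPeriodic fun i => -a i := by
  have h := Tendsto.neg ha
  rw [neg_zero] at h
  exact h.congr fun p => by ring

lemma sub (ha : AlmostPeriodic a) (hb : AlmostPeriodic b) : AlmostPeriodic fun i => a i - b i := by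
  simpa [sub_eq_add_neg] using ha.add hb.neg

lemma comp_sub (ha : AlmostPeriodic a) (l : Site d) : AlmostPeriodic fun i => a (i - l) := by
  rw [almostPeriodic_iff] at ha ⊢
  intro ε hε
  obtain ⟨n, hn⟩ := ha ε hε
  refine ⟨n, fun m i => ?_⟩
  have := hn m (i - l)
  rwa [show i - l + (2 ^ n : ℤ) • m = i + (2 ^ n : ℤ) • m - l by abel] at this

lemma mul {C C' : ℝ} (ha : AlmostPeriodic a) (hb : AlmostPeriodic b) (hC : ∀ i, |a i| ≤ C)
    (hC' : ∀ i, |b i| ≤ C') : AlmostPeriodic fun i => a i * b i := by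
  have h := (ha.abs.const_mul C').add (hb.abs.const_mul C)
  rw [abs_zero, mul_zero, mul_zero, add_zero] at h
  refine squeeze_zero_norm (fun p => ?_) h
  rw [Real.norm_eq_abs, show a (p.2 + p.1) * b (p.2 + p.1) - a p.2 * b p.2 =
    b (p.2 + p.1) * (a (p.2 + p.1) - a p.2) + a p.2 * (b (p.2 + p.1) - b p.2) by ring]
  refine (abs_add_le _ _).trans ?_
  rw [abs_mul, abs_mul]
  gcongr
  · exact hC' _
  · exact hC _

lemma inv {c : ℝ} (ha : AlmostPeriodic a) (hc : 0 < c) (hC : ∀ i, c ≤ |a i|) :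
    AlmostPeriodic fun i => (a i)⁻¹ := by
  have h := ha.abs.const_mul (c⁻¹ * c⁻¹)
  rw [abs_zero, mul_zero] at h
  refine squeeze_zero_norm (fun p => ?_) h
  have h1 : a (p.2 + p.1) ≠ 0 := abs_pos.mp (hc.trans_le (hC _))
  have h2 : a p.2 ≠ 0 := abs_pos.mp (hc.trans_le (hC _))
  have e : (a (p.2 + p.1))⁻¹ - (a p.2)⁻¹ =
      -((a (p.2 + p.1))⁻¹ * (a p.2)⁻¹ * (a (p.2 + p.1) - a p.2)) := by
    field_simp
    ring
  rw [e, norm_neg, Real.norm_eq_abs, abs_mul, abs_mul, abs_inv, abs_inv]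
  gcongr
  · exact hC _
  · exact hC _

lemma of_uniform_limit (h : ∀ ε : ℝ, 0 < ε → ∃ b : Site d → ℝ, AlmostPeriodic b ∧
    ∀ i, |a i - b i| ≤ ε) : AlmostPeriodic a := by
  rw [almostPeriodic_iff]
  intro ε hε
  obtain ⟨b, hb, hab⟩ := h (ε / 3) (by positivity)
  obtain ⟨n, hn⟩ := almostPeriodic_iff.mp hb (ε / 3) (by positivity)
  refine ⟨n, fun m i => ?_⟩
  have h1 := abs_le.mp (hab (i + (2 ^ n : ℤ) • m))
  have h2 := abs_le.mp (hab i)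
  have h3 := abs_lt.mp (hn m i)
  rw [abs_lt]
  constructor <;> linarith

lemma ofReal_mem_limitPeriodic (ha : AlmostPeriodic a) :
    (fun i => (a i : ℂ)) ∈ limitPeriodic d := by
  intro ε hε
  obtain ⟨n, hn⟩ := almostPeriodic_iff.mp ha ε hε
  refine ⟨fun i => (a fun v => i v % 2 ^ n : ℝ), ⟨n, ?_⟩, fun i => ?_⟩
  · rintro i j ⟨m, hm⟩
    have : (fun v => i v % 2 ^ n) = fun v => j v % 2 ^ n := by
      ext v
      have hv := congrFun hm v
      simp only [Pi.sub_apply, Pi.smul_apply, smul_eq_mul] at hv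
      rw [Int.emod_eq_emod_iff_emod_sub_eq_zero, hv]
      simp
    simp only [this]
  · have h := hn (fun v => i v / 2 ^ n) (fun v => i v % 2 ^ n)
    have e : (fun v => i v % 2 ^ n) + (2 ^ n : ℤ) • (fun v => i v / 2 ^ n) = i := by
      ext v
      simp [Int.emod_add_mul_ediv]
    rw [e] at h
    rw [← Complex.ofReal_sub, Complex.norm_real]
    exact h.le

end AlmostPeriodic

/-- Operators with almost periodic diagonals. -/
def MatrixAlmostPeriodic (A : L2 ℝ d →L[ℝ] L2 ℝ d) : Prop :=
  ∀ k : Site d, AlmostPeriodic fun i => entry A i (i - k)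

/-- The operators with almost periodic diagonals dominated by some multiple of the kernel `g`. -/
def Regular (g : Site d → ℝ) (A : L2 ℝ d →L[ℝ] L2 ℝ d) : Prop :=
  MatrixAlmostPeriodic A ∧ ∃ M, 0 ≤ M ∧ Dominated g M A

namespace Regular

variable {g g' : Site d → ℝ} {A B : L2 ℝ d →L[ℝ] L2 ℝ d}

lemma mono (hA : Regular g A) (hg : ∀ k, 0 ≤ g k) (hgg : ∀ k, g k ≤ g' k) : Regular g' A := by
  obtain ⟨h, M, hM, hd⟩ := hA
  exact ⟨h, M, hM, hd.mono hM le_rfl hg hgg⟩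

lemma add (hA : Regular g A) (hB : Regular g B) : Regular g (A + B) := by
  obtain ⟨h, M, hM, hd⟩ := hA
  obtain ⟨h', M', hM', hd'⟩ := hB
  refine ⟨fun k => ?_, M + M', add_nonneg hM hM', hd.add hd'⟩
  simpa using (h k).add (h' k)

lemma neg (hA : Regular g A) : Regular g (-A) := by
  obtain ⟨h, M, hM, hd⟩ := hA
  refine ⟨fun k => ?_, M, hM, hd.neg⟩
  simpa using (h k).neg

lemma sub (hA : Regular g A) (hB : Regular g B) : Regular g (A - B) := by
  rw [sub_eq_add_neg]
  exact hA.add hB.neg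

lemma mul (hg : IsKernel g) (hA : Regular g A) (hB : Regular g B) : Regular g (A * B) := by
  obtain ⟨h, M, hM, hd⟩ := hA
  obtain ⟨h', M', hM', hd'⟩ := hB
  refine ⟨fun k => ?_, M * M', mul_nonneg hM hM', hd.mul hg hM hM' hd'⟩
  have hs : ∀ i, HasSum (fun l => entry A i (i - l) * entry B (i - l) (i - k))
      (entry (A * B) i (i - k)) := fun i =>
    hasSum_entry_mul_sub A B i (i - k)
  have hbA : ∀ i l, |entry A i (i - l)| ≤ M * g l := fun i l => by
    simpa using hd i (i - l)
  have hbB : ∀ i l, |entry B (i - l) (i - k)| ≤ M' * g (k - l) := fun i l => by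
    have := hd' (i - l) (i - k)
    rwa [show i - l - (i - k) = k - l by abel] at this
  have hb : ∀ i l, |entry A i (i - l) * entry B (i - l) (i - k)| ≤ M * M' * g l := by
    intro i l
    rw [abs_mul]
    calc _ ≤ (M * g l) * (M' * 1) :=
          mul_le_mul (hbA i l) ((hbB i l).trans (mul_le_mul_of_nonneg_left (hg.le_one _) hM'))
            (abs_nonneg _) (mul_nonneg hM (hg.nonneg _))
      _ = _ := by ring
  have hterm : ∀ l, AlmostPeriodic fun i => entry A i (i - l) * entry B (i - l) (i - k) := by
    intro l
    refine (h l).mul ?_ (fun i => hbA i l) (fun i => hbB i l)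
    have := (h' (k - l)).comp_sub l
    simpa using this
  have ht := tendsto_tsum_of_dominated_convergence (𝓕 := translationFilter d)
    (f := fun p l => entry A (p.2 + p.1) (p.2 + p.1 - l) *
      entry B (p.2 + p.1 - l) (p.2 + p.1 - k) -
        entry A p.2 (p.2 - l) * entry B (p.2 - l) (p.2 - k))
    (g := fun _ => 0) (bound := fun l => 2 * (M * M' * g l))
    ((hg.summable.mul_left _).mul_left _) hterm (Eventually.of_forall fun p l => by
      refine (abs_sub _ _).trans ?_
      have h1 := hb (p.2 + p.1) l
      have h2 := hb p.2 l
      linarith)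
  rw [tsum_zero] at ht
  refine ht.congr fun p => ?_
  exact ((hs _).sub (hs _)).tsum_eq

lemma diagPart (hA : Regular g A) : Regular g (diagPart A) := by
  obtain ⟨h, M, hM, hd⟩ := hA
  refine ⟨fun k => ?_, M, hM, hd.diagPart⟩
  simp only [entry_diagPart]
  by_cases hk : k = 0
  · subst hk
    simpa using h 0
  · have : ∀ i : Site d, i ≠ i - k := fun i hi => hk (sub_eq_self.mp hi.symm)
    simpa [this] using AlmostPeriodic.const 0

lemma one (hg : IsKernel g) (hg0 : 0 < g 0) : Regular g (1 : L2 ℝ d →L[ℝ] L2 ℝ d) := by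
  refine ⟨fun k => ?_, 1 / g 0, by positivity,
    Dominated.of_diagonal hg0 hg.nonneg zero_le_one (fun i j h => by simp [h]) fun i => by simp⟩
  by_cases hk : k = 0
  · subst hk
    simpa using AlmostPeriodic.const 1
  · have : ∀ i : Site d, i ≠ i - k := fun i hi => hk (sub_eq_self.mp hi.symm)
    simpa [this] using AlmostPeriodic.const 0

lemma diagOp (hg : IsKernel g) (hg0 : 0 < g 0) {q : Site d → ℝ} {C : ℝ} (hq : ∀ i, |q i| ≤ C)
    (hqp : AlmostPeriodic q) : Regular g (diagOp q) := by
  have hC : 0 ≤ C := (abs_nonneg _).trans (hq 0)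
  replace hq : ∀ i, ‖q i‖ ≤ C := hq
  refine ⟨fun k => ?_, C / g 0, by positivity,
    Dominated.of_diagonal hg0 hg.nonneg hC (fun i j h => by rw [entry_diagOp hq, if_neg h])
      fun i => by rw [entry_diagOp hq, if_pos rfl]; exact hq i⟩
  simp only [entry_diagOp hq]
  by_cases hk : k = 0
  · subst hk
    simpa using hqp
  · have : ∀ i : Site d, i ≠ i - k := fun i hi => hk (sub_eq_self.mp hi.symm)
    simpa [this] using AlmostPeriodic.const 0

end Regular

end LimitPeriodic

/-! ### The Newton step -/

section Newton

variable {d : ℕ}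

lemma newton_identity {R : Type*} [Ring R] {T T' D Q V X P E : R}
    (hE : E = (T + D + Q) * V - V * D) (hX : D * X - X * D = P - E) :
    (T' + D + (Q - P)) * (V * (1 + X)) - V * (1 + X) * D =
      E * X - (P * X + P * ((V - 1) * X)) + (V - 1) * (P - E) - P * (V - 1) +
        ((T' - T) + (T' - T) * (V * (1 + X) - 1)) := by
  have h : (T' + D + (Q - P)) * (V * (1 + X)) - V * (1 + X) * D -
      (E * X - (P * X + P * ((V - 1) * X)) + (V - 1) * (P - E) - P * (V - 1) +
        ((T' - T) + (T' - T) * (V * (1 + X) - 1))) = V * ((D * X - X * D) - (P - E)) := by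
    rw [hE]
    noncomm_ring
  rw [hX, sub_self, mul_zero] at h
  exact sub_eq_zero.mp h

lemma newton_sub_one {R : Type*} [Ring R] (V X : R) :
    V * (1 + X) - 1 = (V - 1) + (X + (V - 1) * X) := by noncomm_ring

variable {g : Site d → ℝ} {η x ε μ : ℝ} {T T' D Q V X : L2 ℝ d →L[ℝ] L2 ℝ d}

lemma dominated_newton_sub_one (hg : IsKernel g) (hη : 0 ≤ η) (hx : 0 ≤ x)
    (hV : Dominated g η (V - 1)) (hX : Dominated g x X) :
    Dominated g (η + (x + η * x)) (V * (1 + X) - 1) := by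
  rw [newton_sub_one]
  exact hV.add (hX.add (hV.mul hg hη hx hX))

lemma dominated_newton_error (hg : IsKernel g) (hη : 0 ≤ η) (hx : 0 ≤ x) (hε : 0 ≤ ε)
    (hμ : 0 ≤ μ) (hV : Dominated g η (V - 1)) (hX : Dominated g x X)
    (hE : Dominated g ε ((T + D + Q) * V - V * D))
    (hT : Dominated g μ (T' - T))
    (heq : D * X - X * D =
      diagPart ((T + D + Q) * V - V * D) - ((T + D + Q) * V - V * D)) :
    Dominated g (ε * x + (ε * x + ε * (η * x)) + η * ε + ε * η + (μ + μ * (η + (x + η * x))))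
      ((T' + D + (Q - diagPart ((T + D + Q) * V - V * D))) * (V * (1 + X)) -
        V * (1 + X) * D) := by
  rw [newton_identity rfl heq]
  have hV' := dominated_newton_sub_one hg hη hx hV hX
  have hP := hE.diagPart
  have hEP : Dominated g ε
      (diagPart ((T + D + Q) * V - V * D) - ((T + D + Q) * V - V * D)) := by
    rw [← neg_sub]
    exact hE.sub_diagPart.neg
  exact ((((hE.mul hg hε hx hX).sub
    ((hP.mul hg hε hx hX).add (hP.mul hg hε (by positivity) (hV.mul hg hη hx hX)))).add
      (hV.mul hg hη hε hEP)).sub (hP.mul hg hε hη hV)).add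
        (hT.add (hT.mul hg hμ (by positivity) hV'))

end Newton

/-! ### The homological equation -/

section Homological

variable {d : ℕ}

/-- Bounded almost periodic sequences whose translates are separated polynomially. -/
structure IsDistal (c τ : ℝ) (D : Site d → ℝ) : Prop where
  almostPeriodic : AlmostPeriodic D
  abs_le_one : ∀ i, |D i| ≤ 1
  separated : ∀ i j, i ≠ j → c * bracket (i - j) ^ (-τ) ≤ |D i - D j|

lemma exists_homological {σ τ c C : ℝ} (hσ : (d : ℝ) < σ) (hc : 0 < c)
    (hC1 : 1 ≤ C) (hC : ∀ (k : Site d) (n : ℕ),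
      bracket k ^ τ * Real.exp (-((2 : ℝ)⁻¹ ^ (n + 1) * ‖k‖)) ≤ C * ((2 : ℝ) ^ τ) ^ n)
    {D : Site d → ℝ} (hD : IsDistal c τ D) (n : ℕ) {ε : ℝ} (hε : 0 ≤ ε)
    {E : L2 ℝ d →L[ℝ] L2 ℝ d} (hE : MatrixAlmostPeriodic E)
    (hEd : Dominated (kernel σ ((2 : ℝ)⁻¹ ^ n)) ε E) :
    ∃ X : L2 ℝ d →L[ℝ] L2 ℝ d,
      diagOp D * X - X * diagOp D = diagPart E - E ∧ MatrixAlmostPeriodic X ∧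
      Dominated (kernel σ ((2 : ℝ)⁻¹ ^ (n + 1))) (c⁻¹ * C * ((2 : ℝ) ^ τ) ^ n * ε) X := by
  have hsep : ∀ i j, i ≠ j → |D i - D j|⁻¹ ≤ c⁻¹ * bracket (i - j) ^ τ := by
    intro i j hij
    have hb := bracket_pos (i - j)
    have h := hD.separated i j hij
    have hpos : 0 < c * bracket (i - j) ^ (-τ) := by positivity
    calc |D i - D j|⁻¹ ≤ (c * bracket (i - j) ^ (-τ))⁻¹ := inv_anti₀ hpos h
      _ = c⁻¹ * bracket (i - j) ^ τ := by rw [mul_inv, Real.rpow_neg hb.le, inv_inv]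
  have hbd : ∀ i j, ‖-(entry E i j) / (D i - D j)‖ ≤
      c⁻¹ * C * ((2 : ℝ) ^ τ) ^ n * ε * kernel σ ((2 : ℝ)⁻¹ ^ (n + 1)) (i - j) := by
    intro i j
    have hk := (kernel_pos σ ((2 : ℝ)⁻¹ ^ (n + 1)) (i - j)).le
    have hC0 : 0 ≤ C := by linarith
    by_cases hij : i = j
    · subst hij
      rw [sub_self, div_zero, norm_zero]
      positivity
    · have hb := bracket_pos (i - j)
      rw [Real.norm_eq_abs, abs_div, abs_neg, div_eq_mul_inv]
      have hsplit : kernel σ ((2 : ℝ)⁻¹ ^ n) (i - j) =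
          kernel σ ((2 : ℝ)⁻¹ ^ (n + 1)) (i - j) *
            Real.exp (-((2 : ℝ)⁻¹ ^ (n + 1) * ‖i - j‖)) := by
        unfold kernel
        rw [show -((2 : ℝ)⁻¹ ^ n * ‖i - j‖) = -((2 : ℝ)⁻¹ ^ (n + 1) * ‖i - j‖) +
          -((2 : ℝ)⁻¹ ^ (n + 1) * ‖i - j‖) by rw [pow_succ]; ring, Real.exp_add]
        ring
      calc |entry E i j| * |D i - D j|⁻¹
          ≤ (ε * kernel σ ((2 : ℝ)⁻¹ ^ n) (i - j)) * (c⁻¹ * bracket (i - j) ^ τ) :=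
            mul_le_mul (hEd i j) (hsep i j hij) (by positivity)
              (mul_nonneg hε (kernel_pos _ _ _).le)
        _ = ε * c⁻¹ * kernel σ ((2 : ℝ)⁻¹ ^ (n + 1)) (i - j) *
            (bracket (i - j) ^ τ * Real.exp (-((2 : ℝ)⁻¹ ^ (n + 1) * ‖i - j‖))) := by
            rw [hsplit]; ring
        _ ≤ ε * c⁻¹ * kernel σ ((2 : ℝ)⁻¹ ^ (n + 1)) (i - j) * (C * ((2 : ℝ) ^ τ) ^ n) := by
            have := (kernel_pos σ ((2 : ℝ)⁻¹ ^ (n + 1)) (i - j)).le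
            exact mul_le_mul_of_nonneg_left (hC (i - j) n) (by positivity)
        _ = _ := by ring
  have hker := isKernel_kernel (d := d) (ρ := (2 : ℝ)⁻¹ ^ (n + 1)) hσ (by positivity)
  set X : L2 ℝ d →L[ℝ] L2 ℝ d := ofEntries fun i j => -(entry E i j) / (D i - D j) with hXdef
  have hX : ∀ i j, entry X i j = -(entry E i j) / (D i - D j) :=
    entry_ofEntries (hker.summable.mul_left _) hbd
  refine ⟨X, ?_, ?_, ?_⟩
  · have hDn : ∀ i, ‖D i‖ ≤ 1 := hD.abs_le_one
    refine operator_ext fun i j => ?_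
    rw [entry_sub, entry_sub, entry_diagOp_mul hDn, entry_mul_diagOp hDn, hX, entry_diagPart]
    by_cases hij : i = j
    · subst hij
      simp
    · have hne : D i - D j ≠ 0 := by
        have hb := bracket_pos (i - j)
        exact abs_pos.mp ((by positivity : 0 < c * bracket (i - j) ^ (-τ)).trans_le
          (hD.separated i j hij))
      rw [if_neg hij]
      field_simp
      ring
  · intro k
    simp only [hX]
    by_cases hk : k = 0
    · subst hk
      simpa using AlmostPeriodic.const 0
    · have hne : ∀ i : Site d, i ≠ i - k := fun i hi => hk (sub_eq_self.mp hi.symm)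
      have hb := bracket_pos k
      simp only [div_eq_mul_inv]
      refine (hE k).neg.mul (C := ‖E‖) (C' := c⁻¹ * bracket k ^ τ)
        ((hD.almostPeriodic.sub (hD.almostPeriodic.comp_sub k)).inv
          (c := c * bracket k ^ (-τ)) (by positivity) fun i => ?_) (fun i => ?_) fun i => ?_
      · simpa using hD.separated i (i - k) (hne i)
      · rw [abs_neg]
        exact norm_entry_le E _ _
      · rw [abs_inv]
        simpa using hsep i (i - k) (hne i)
  · intro i j
    rw [hX]
    exact hbd i j

end Homological

/-! ### The iteration -/

section Iteration

variable {d : ℕ}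

/-- The properties of the approximate solutions of the conjugation equation. -/
structure IsApproxConjugation (g : Site d → ℝ) (η ε : ℝ) (T D V Q : L2 ℝ d →L[ℝ] L2 ℝ d) :
    Prop where
  near_one : Dominated g η (V - 1)
  error : Dominated g ε ((T + D + Q) * V - V * D)
  almostPeriodic : MatrixAlmostPeriodic V
  almostPeriodic_diag : MatrixAlmostPeriodic Q
  diagonal : ∀ i j, i ≠ j → entry Q i j = 0

lemma IsApproxConjugation.exists_next {σ τ c C : ℝ} (hσ : (d : ℝ) < σ) (hc : 0 < c)
    (hC1 : 1 ≤ C) (hC : ∀ (k : Site d) (n : ℕ),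
      bracket k ^ τ * Real.exp (-((2 : ℝ)⁻¹ ^ (n + 1) * ‖k‖)) ≤ C * ((2 : ℝ) ^ τ) ^ n)
    {D : Site d → ℝ} (hD : IsDistal c τ D) {n : ℕ} {η ε x μ ε' : ℝ}
    (hε : 0 ≤ ε) (hη : 0 ≤ η) (hμ : 0 ≤ μ)
    (hx : x = c⁻¹ * C * ((2 : ℝ) ^ τ) ^ n * ε)
    {T T' V Q : L2 ℝ d →L[ℝ] L2 ℝ d}
    (h : IsApproxConjugation (kernel σ ((2 : ℝ)⁻¹ ^ n)) η ε T (diagOp D) V Q)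
    (hT : Regular (kernel σ ((2 : ℝ)⁻¹ ^ n)) T)
    (hTT : Dominated (kernel σ ((2 : ℝ)⁻¹ ^ (n + 1))) μ (T' - T))
    (hη' : η + 2 * x ≤ 1 / 2) (hε' : ε * (5 * (η + 2 * x)) + 2 * μ ≤ ε') :
    ∃ V' Q' : L2 ℝ d →L[ℝ] L2 ℝ d,
      IsApproxConjugation (kernel σ ((2 : ℝ)⁻¹ ^ (n + 1))) (η + 2 * x) ε' T' (diagOp D) V' Q' ∧
      Dominated (kernel σ ((2 : ℝ)⁻¹ ^ (n + 1))) (2 * x) (V' - V) ∧ ‖Q' - Q‖ ≤ ε := by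
  have hDn : ∀ i, ‖D i‖ ≤ 1 := hD.abs_le_one
  set g := (kernel σ ((2 : ℝ)⁻¹ ^ n) : Site d → ℝ) with hgdef
  set g' := (kernel σ ((2 : ℝ)⁻¹ ^ (n + 1)) : Site d → ℝ) with hgdef'
  have hg : IsKernel g := isKernel_kernel hσ (by positivity)
  have hg' : IsKernel g' := isKernel_kernel hσ (by positivity)
  have hgg : ∀ k, g k ≤ g' k := fun k =>
    kernel_anti σ (pow_le_pow_of_le_one (by norm_num) (by norm_num) (Nat.le_succ n)) k
  have hg0 : 0 < g 0 := kernel_pos _ _ _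
  have hx0 : 0 ≤ x := by
    have : 0 ≤ C := by linarith
    rw [hx]; positivity
  have hRV : Regular g V := by
    refine ⟨h.almostPeriodic, η + 1 / g 0, by positivity, ?_⟩
    have h1 : Dominated g (1 / g 0) (1 : L2 ℝ d →L[ℝ] L2 ℝ d) :=
      Dominated.of_diagonal hg0 hg.nonneg zero_le_one (fun i j h => by simp [h]) fun i => by simp
    simpa using h.near_one.add h1
  have hRQ : Regular g Q := ⟨h.almostPeriodic_diag, ‖Q‖ / g 0, by positivity,
    Dominated.of_diagonal hg0 hg.nonneg (norm_nonneg _) h.diagonal fun i => norm_entry_le Q i i⟩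
  have hRD : Regular g (diagOp D) := Regular.diagOp hg hg0 hD.abs_le_one hD.almostPeriodic
  have hRE : Regular g ((T + diagOp D + Q) * V - V * diagOp D) :=
    (Regular.mul hg ((hT.add hRD).add hRQ) hRV).sub (Regular.mul hg hRV hRD)
  obtain ⟨X, hXeq, hXap, hXd⟩ := exists_homological hσ hc hC1 hC hD n hε hRE.1 h.error
  rw [← hx] at hXd
  have hRX : Regular g' X := ⟨hXap, x, hx0, hXd⟩
  have hRV' : Regular g' V := hRV.mono hg.nonneg hgg
  have hV := h.near_one.mono hη le_rfl hg.nonneg hgg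
  have hE := h.error.mono hε le_rfl hg.nonneg hgg
  have hη1 : η ≤ 1 := by linarith
  have hηx : η * x ≤ x := mul_le_of_le_one_left hx0 hη1
  have hVX : V * (1 + X) - V = X + (V - 1) * X := by noncomm_ring
  refine ⟨V * (1 + X), Q - diagPart ((T + diagOp D + Q) * V - V * diagOp D),
    ⟨?_, ?_, ?_, ?_, ?_⟩, ?_, ?_⟩
  · exact (dominated_newton_sub_one hg' hη hx0 hV hXd).mono (by positivity)
      (by linarith) hg'.nonneg fun _ => le_rfl
  · refine (dominated_newton_error hg' hη hx0 hε hμ hV hXd hE hTT hXeq).mono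
      (le_trans (by positivity) hε') (le_trans ?_ hε') hg'.nonneg fun _ => le_rfl
    have h1 : ε * (η * x) ≤ ε * x := mul_le_mul_of_nonneg_left hηx hε
    have h2 : μ * (η + (x + η * x)) ≤ μ * 1 := mul_le_mul_of_nonneg_left (by linarith) hμ
    have h3 : 0 ≤ ε * η := mul_nonneg hε hη
    have h4 : 0 ≤ ε * x := mul_nonneg hε hx0
    nlinarith
  · have h1 : Regular g' (1 : L2 ℝ d →L[ℝ] L2 ℝ d) := Regular.one hg' (kernel_pos _ _ _)
    exact (Regular.mul hg' hRV' (h1.add hRX)).1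
  · exact (hRQ.sub hRE.diagPart).1
  · intro i j hij
    rw [entry_sub, h.diagonal i j hij, entry_diagPart, if_neg hij, sub_zero]
  · rw [hVX]
    exact (hXd.add (hV.mul hg' hη hx0 hXd)).mono (by positivity) (by linarith) hg'.nonneg
      fun _ => le_rfl
  · rw [sub_sub_cancel_left, norm_neg]
    exact hE.diagPart.norm_le hg' hε

end Iteration

section Limit

variable {d : ℕ}

lemma exists_approxConjugations {σ τ c C : ℝ} (hσ : (d : ℝ) < σ) (hc : 0 < c)
    (hC1 : 1 ≤ C) (hC : ∀ (k : Site d) (n : ℕ),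
      bracket k ^ τ * Real.exp (-((2 : ℝ)⁻¹ ^ (n + 1) * ‖k‖)) ≤ C * ((2 : ℝ) ^ τ) ^ n)
    {D : Site d → ℝ} (hD : IsDistal c τ D) {θ r ε x μ : ℝ} (hθ : 0 < θ) (hθ1 : θ < 1)
    (hr : r = θ * 2 ^ τ) (hr1 : r < 1) (hε : 0 ≤ ε) (hμ : 0 ≤ μ) (hx : x = c⁻¹ * C * ε)
    {T : ℕ → L2 ℝ d →L[ℝ] L2 ℝ d} (hT : ∀ n, Regular (kernel σ ((2 : ℝ)⁻¹ ^ n)) (T n))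
    (hT0 : Dominated (kernel σ 1) ε (T 0))
    (hTs : ∀ n, Dominated (kernel σ ((2 : ℝ)⁻¹ ^ (n + 1))) (μ * θ ^ n) (T (n + 1) - T n))
    (hxθ : 2 * x / (1 - r) ≤ θ / 10) (hμε : 4 * μ ≤ ε * θ) :
    ∃ V Q : ℕ → L2 ℝ d →L[ℝ] L2 ℝ d, V 0 = 1 ∧
      (∀ n, IsApproxConjugation (kernel σ ((2 : ℝ)⁻¹ ^ n))
        (∑ m ∈ Finset.range n, 2 * x * r ^ m) (ε * θ ^ n) (T n) (diagOp D) (V n) (Q n)) ∧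
      (∀ n, Dominated (kernel σ ((2 : ℝ)⁻¹ ^ (n + 1))) (2 * x * r ^ n) (V (n + 1) - V n)) ∧
      ∀ n, ‖Q (n + 1) - Q n‖ ≤ ε * θ ^ n := by
  have hr0 : 0 ≤ r := by rw [hr]; positivity
  have hx0 : 0 ≤ x := by
    have : 0 ≤ C := by linarith
    rw [hx]; positivity
  have hsum : ∀ n, ∑ m ∈ Finset.range n, 2 * x * r ^ m ≤ 2 * x / (1 - r) := by
    intro n
    rw [← Finset.mul_sum, div_eq_mul_inv, ← tsum_geometric_of_lt_one hr0 hr1]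
    refine mul_le_mul_of_nonneg_left ?_ (by positivity)
    exact (summable_geometric_of_lt_one hr0 hr1).sum_le_tsum _ fun m _ => by positivity
  have step : ∀ (n : ℕ) (p : (L2 ℝ d →L[ℝ] L2 ℝ d) × (L2 ℝ d →L[ℝ] L2 ℝ d)),
      IsApproxConjugation (kernel σ ((2 : ℝ)⁻¹ ^ n))
        (∑ m ∈ Finset.range n, 2 * x * r ^ m) (ε * θ ^ n) (T n) (diagOp D) p.1 p.2 →
      ∃ p' : (L2 ℝ d →L[ℝ] L2 ℝ d) × (L2 ℝ d →L[ℝ] L2 ℝ d),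
        IsApproxConjugation (kernel σ ((2 : ℝ)⁻¹ ^ (n + 1)))
          (∑ m ∈ Finset.range (n + 1), 2 * x * r ^ m) (ε * θ ^ (n + 1)) (T (n + 1)) (diagOp D)
            p'.1 p'.2 ∧
        Dominated (kernel σ ((2 : ℝ)⁻¹ ^ (n + 1))) (2 * x * r ^ n) (p'.1 - p.1) ∧
        ‖p'.2 - p.2‖ ≤ ε * θ ^ n := by
    rintro n ⟨V, Q⟩ h
    have hs := hsum (n + 1)
    rw [Finset.sum_range_succ, mul_assoc 2 x (r ^ n)] at hs
    obtain ⟨V', Q', h1, h2, h3⟩ := IsApproxConjugation.exists_next (x := x * r ^ n)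
      (ε' := ε * θ ^ (n + 1)) hσ hc hC1 hC hD
      (by positivity) (Finset.sum_nonneg fun m _ => by positivity)
      (mul_nonneg hμ (pow_nonneg hθ.le n)) (by rw [hx, hr, mul_pow]; ring) h (hT n) (hTs n)
      (by linarith) (by
        have e1 : ε * θ ^ n * (5 * (∑ m ∈ Finset.range n, 2 * x * r ^ m + 2 * (x * r ^ n))) ≤
            ε * θ ^ n * (θ / 2) := by
          refine mul_le_mul_of_nonneg_left ?_ (by positivity)
          linarith
        have e2 : 4 * μ * θ ^ n ≤ ε * θ * θ ^ n :=
          mul_le_mul_of_nonneg_right hμε (by positivity)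
        rw [pow_succ]
        linarith)
    refine ⟨(V', Q'), ?_, ?_, h3⟩
    · rw [Finset.sum_range_succ, mul_assoc 2 x (r ^ n)]
      exact h1
    · rw [mul_assoc 2 x (r ^ n)]
      exact h2
  choose! f hf1 hf2 hf3 using step
  let s : ℕ → (L2 ℝ d →L[ℝ] L2 ℝ d) × (L2 ℝ d →L[ℝ] L2 ℝ d) :=
    fun n => Nat.rec (1, 0) (fun n p => f n p) n
  have hs : ∀ n, IsApproxConjugation (kernel σ ((2 : ℝ)⁻¹ ^ n))
      (∑ m ∈ Finset.range n, 2 * x * r ^ m) (ε * θ ^ n) (T n) (diagOp D) (s n).1 (s n).2 := by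
    intro n
    induction n with
    | zero =>
      have hk : IsKernel (kernel σ 1 : Site d → ℝ) := isKernel_kernel hσ zero_le_one
      refine ⟨fun i j => ?_, ?_, ?_, fun k => ?_, fun i j _ => ?_⟩
      · simp [s]
      · simpa [s] using hT0
      · exact (Regular.one hk (kernel_pos _ _ _)).1
      · simpa [s] using AlmostPeriodic.const 0
      · simp [s]
    | succ n ih => exact hf1 n (s n) ih
  exact ⟨fun n => (s n).1, fun n => (s n).2, rfl, hs, fun n => hf2 n (s n) (hs n),
    fun n => hf3 n (s n) (hs n)⟩

lemma exists_limit_of_norm_sub_le {E : Type*} [NormedAddCommGroup E] [CompleteSpace E]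
    {u : ℕ → E} {a r : ℝ} (hr : r < 1) (h : ∀ n, ‖u (n + 1) - u n‖ ≤ a * r ^ n) :
    ∃ l, Tendsto u atTop (𝓝 l) :=
  cauchySeq_tendsto_of_complete (cauchySeq_of_le_geometric r a hr fun n => by
    rw [dist_comm, dist_eq_norm]
    exact h n)

lemma tendsto_entry {u : ℕ → L2 ℝ d →L[ℝ] L2 ℝ d} {A : L2 ℝ d →L[ℝ] L2 ℝ d}
    (h : Tendsto u atTop (𝓝 A)) (i j : Site d) :
    Tendsto (fun n => entry (u n) i j) atTop (𝓝 (entry A i j)) := by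
  rw [tendsto_iff_norm_sub_tendsto_zero] at h ⊢
  refine squeeze_zero (fun n => norm_nonneg _) (fun n => ?_) h
  rw [← entry_sub]
  exact norm_entry_le _ _ _

lemma exists_conjugation {σ τ c C : ℝ} (hσ : (d : ℝ) < σ) (hc : 0 < c)
    (hC1 : 1 ≤ C) (hC : ∀ (k : Site d) (n : ℕ),
      bracket k ^ τ * Real.exp (-((2 : ℝ)⁻¹ ^ (n + 1) * ‖k‖)) ≤ C * ((2 : ℝ) ^ τ) ^ n)
    {D : Site d → ℝ} (hD : IsDistal c τ D) {θ r ε x μ : ℝ} (hθ : 0 < θ) (hθ1 : θ < 1)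
    (hr : r = θ * 2 ^ τ) (hr1 : r < 1) (hε : 0 ≤ ε) (hμ : 0 ≤ μ) (hx : x = c⁻¹ * C * ε)
    {T : ℕ → L2 ℝ d →L[ℝ] L2 ℝ d} (hT : ∀ n, Regular (kernel σ ((2 : ℝ)⁻¹ ^ n)) (T n))
    (hT0 : Dominated (kernel σ 1) ε (T 0))
    (hTs : ∀ n, Dominated (kernel σ ((2 : ℝ)⁻¹ ^ (n + 1))) (μ * θ ^ n) (T (n + 1) - T n))
    (hxθ : 2 * x / (1 - r) ≤ θ / 10) (hμε : 4 * μ ≤ ε * θ)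
    {b C' : ℝ} (hb : r * 2 ^ b < 1) (hC' : ∀ (k : Site d) (n : ℕ),
      bracket k ^ b * Real.exp (-((2 : ℝ)⁻¹ ^ (n + 1) * ‖k‖)) ≤ C' * ((2 : ℝ) ^ b) ^ n) :
    ∃ S V Q : L2 ℝ d →L[ℝ] L2 ℝ d, Tendsto T atTop (𝓝 S) ∧
      (S + diagOp D + Q) * V = V * diagOp D ∧ (∀ i j, i ≠ j → entry Q i j = 0) ∧
      AlmostPeriodic (fun i => entry Q i i) ∧
      ∀ i j, |entry (V - 1) i j| ≤ 2 * x * C' / (1 - r * 2 ^ b) * bracket (i - j) ^ (-(σ + b)) := by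
  have hx0 : 0 ≤ x := by
    have : 0 ≤ C := by linarith
    rw [hx]; positivity
  have hr0 : 0 ≤ r := by rw [hr]; positivity
  have hk : ∀ n : ℕ, IsKernel (kernel σ ((2 : ℝ)⁻¹ ^ n) : Site d → ℝ) := fun n =>
    isKernel_kernel hσ (by positivity)
  obtain ⟨V, Q, hV0, hVQ, hVs, hQs⟩ := exists_approxConjugations hσ hc hC1 hC hD hθ hθ1 hr hr1
    hε hμ hx hT hT0 hTs hxθ hμε
  obtain ⟨S, hS⟩ := exists_limit_of_norm_sub_le hθ1 fun n =>
    (hTs n).norm_le (hk _) (by positivity)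
  obtain ⟨Vl, hVl⟩ := exists_limit_of_norm_sub_le hr1 fun n =>
    (hVs n).norm_le (hk _) (by positivity)
  obtain ⟨Ql, hQl⟩ := exists_limit_of_norm_sub_le hθ1 hQs
  refine ⟨S, Vl, Ql, hS, ?_, ?_, ?_, ?_⟩
  · have h1 : Tendsto (fun n => (T n + diagOp D + Q n) * V n - V n * diagOp D) atTop
        (𝓝 ((S + diagOp D + Ql) * Vl - Vl * diagOp D)) :=
      (((hS.add_const _).add hQl).mul hVl).sub (hVl.mul_const _)
    have h2 : Tendsto (fun n => (T n + diagOp D + Q n) * V n - V n * diagOp D) atTop (𝓝 0) := by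
      refine squeeze_zero_norm
        (fun n => (hVQ n).error.norm_le (hk n) (by positivity)) ?_
      simpa using (tendsto_pow_atTop_nhds_zero_of_lt_one hθ.le hθ1).const_mul ε
    exact sub_eq_zero.mp (tendsto_nhds_unique h1 h2)
  · intro i j hij
    refine tendsto_nhds_unique (tendsto_entry hQl i j) ?_
    simp only [fun n => (hVQ n).diagonal i j hij]
    exact tendsto_const_nhds
  · refine AlmostPeriodic.of_uniform_limit fun ε' hε' => ?_
    obtain ⟨n, hn⟩ := (Metric.tendsto_atTop.mp hQl) ε' hε'
    refine ⟨fun i => entry (Q n) i i, by simpa using (hVQ n).almostPeriodic_diag 0, fun i => ?_⟩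
    rw [← entry_sub, ← Real.norm_eq_abs]
    have := hn n le_rfl
    rw [dist_comm, dist_eq_norm] at this
    exact (norm_entry_le _ _ _).trans this.le
  · intro i j
    have hbr := bracket_pos (i - j)
    have hd : ∀ n, dist (entry (V n) i j) (entry (V (n + 1)) i j) ≤
        2 * x * C' * bracket (i - j) ^ (-(σ + b)) * (r * 2 ^ b) ^ n := by
      intro n
      rw [dist_comm, Real.dist_eq, ← entry_sub]
      refine (hVs n i j).trans ?_
      have hker : kernel σ ((2 : ℝ)⁻¹ ^ (n + 1)) (i - j) ≤
          bracket (i - j) ^ (-(σ + b)) * (C' * ((2 : ℝ) ^ b) ^ n) := by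
        calc kernel σ ((2 : ℝ)⁻¹ ^ (n + 1)) (i - j) ≤
              bracket (i - j) ^ (-σ) * Real.exp (-((2 : ℝ)⁻¹ ^ (n + 1) * ‖i - j‖)) :=
              div_le_self (by positivity) (one_le_kernelConst d σ)
          _ = bracket (i - j) ^ (-(σ + b)) * (bracket (i - j) ^ b *
                Real.exp (-((2 : ℝ)⁻¹ ^ (n + 1) * ‖i - j‖))) := by
              rw [← mul_assoc, ← Real.rpow_add hbr]
              congr 2
              ring
          _ ≤ _ := mul_le_mul_of_nonneg_left (hC' _ _) (by positivity)
      calc _ ≤ 2 * x * r ^ n * (bracket (i - j) ^ (-(σ + b)) * (C' * ((2 : ℝ) ^ b) ^ n)) :=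
            mul_le_mul_of_nonneg_left hker (by positivity)
        _ = _ := by rw [mul_pow]; ring
    have h := dist_le_of_le_geometric_of_tendsto₀ _ _ hb hd (tendsto_entry hVl i j)
    rw [dist_comm, Real.dist_eq, hV0, ← entry_sub] at h
    exact h.trans_eq (by ring)

end Limit

section Truncation

variable {d : ℕ}

/-- The hopping operator with the hops of length at most `2 ^ n`. -/
def truncatedHopping (φ : Site d → ℝ) (n : ℕ) : L2 ℝ d →L[ℝ] L2 ℝ d :=
  ofEntries fun i j => if ‖i - j‖ ≤ 2 ^ n then φ (i - j) else 0

variable {φ : Site d → ℝ} {ε p σ : ℝ}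

lemma bracket_rpow_le_kernel {k : Site d} {n : ℕ} (hk : ‖k‖ ≤ 2 ^ n) :
    bracket k ^ (-σ) ≤ kernelConst d σ * Real.exp 1 * kernel σ ((2 : ℝ)⁻¹ ^ n) k := by
  have hb := bracket_pos k
  have hK := kernelConst_pos d σ
  have h1 : (2 : ℝ)⁻¹ ^ n * ‖k‖ ≤ 1 := by
    rw [inv_pow, inv_mul_le_iff₀ (by positivity), mul_one]
    exact hk
  have h2 : 1 ≤ Real.exp 1 * Real.exp (-((2 : ℝ)⁻¹ ^ n * ‖k‖)) := by
    rw [← Real.exp_add]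
    exact Real.one_le_exp (by linarith)
  calc bracket k ^ (-σ) ≤ bracket k ^ (-σ) *
        (Real.exp 1 * Real.exp (-((2 : ℝ)⁻¹ ^ n * ‖k‖))) :=
        le_mul_of_one_le_right (by positivity) h2
    _ = _ := by
        unfold kernel
        field_simp

lemma truncatedHopping_summable_bound (hσ : (d : ℝ) < σ) (hp : σ ≤ p) :
    Summable fun k : Site d => ε * bracket k ^ (-p) :=
  (summable_bracket_rpow (hσ.trans_le hp)).mul_left ε

lemma entry_truncatedHopping (hσ : (d : ℝ) < σ) (hp : σ ≤ p)
    (hφ : ∀ k, |φ k| ≤ ε * bracket k ^ (-p)) (n : ℕ) (i j : Site d) :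
    entry (truncatedHopping φ n) i j = if ‖i - j‖ ≤ 2 ^ n then φ (i - j) else 0 := by
  refine entry_ofEntries (truncatedHopping_summable_bound (ε := ε) hσ hp) (fun i j => ?_) i j
  have h := hφ (i - j)
  split_ifs
  · exact h
  · rw [norm_zero]
    exact (abs_nonneg _).trans h

lemma dominated_truncatedHopping (hσ : (d : ℝ) < σ) (hp : σ ≤ p) (hε : 0 ≤ ε)
    (hφ : ∀ k, |φ k| ≤ ε * bracket k ^ (-p)) (n : ℕ) :
    Dominated (kernel σ ((2 : ℝ)⁻¹ ^ n)) (ε * (kernelConst d σ * Real.exp 1))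
      (truncatedHopping φ n) := by
  intro i j
  have hK := kernelConst_pos d σ
  have hk := (kernel_pos σ ((2 : ℝ)⁻¹ ^ n) (i - j)).le
  rw [entry_truncatedHopping hσ hp hφ]
  split_ifs with h
  · refine (hφ _).trans ?_
    rw [mul_assoc]
    refine mul_le_mul_of_nonneg_left ?_ hε
    exact (bracket_rpow_le_rpow _ (by linarith)).trans (bracket_rpow_le_kernel h)
  · rw [abs_zero]
    positivity

lemma regular_truncatedHopping (hσ : (d : ℝ) < σ) (hp : σ ≤ p) (hε : 0 ≤ ε)
    (hφ : ∀ k, |φ k| ≤ ε * bracket k ^ (-p)) (n : ℕ) :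
    Regular (kernel σ ((2 : ℝ)⁻¹ ^ n)) (truncatedHopping φ n) := by
  have hK := kernelConst_pos d σ
  refine ⟨fun k => ?_, _, by positivity, dominated_truncatedHopping hσ hp hε hφ n⟩
  simp only [entry_truncatedHopping hσ hp hφ, sub_sub_cancel]
  exact AlmostPeriodic.const _

lemma dominated_truncatedHopping_sub (hσ : (d : ℝ) < σ) (hp : σ ≤ p) (hε : 0 ≤ ε)
    (hφ : ∀ k, |φ k| ≤ ε * bracket k ^ (-p)) (n : ℕ) :
    Dominated (kernel σ ((2 : ℝ)⁻¹ ^ (n + 1)))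
      (ε * (kernelConst d σ * Real.exp 1) * ((2 : ℝ) ^ (-(p - σ))) ^ n)
      (truncatedHopping φ (n + 1) - truncatedHopping φ n) := by
  intro i j
  have hK := kernelConst_pos d σ
  have hk := (kernel_pos σ ((2 : ℝ)⁻¹ ^ (n + 1)) (i - j)).le
  have hpos : 0 ≤ ε * (kernelConst d σ * Real.exp 1) * ((2 : ℝ) ^ (-(p - σ))) ^ n *
      kernel σ ((2 : ℝ)⁻¹ ^ (n + 1)) (i - j) := by positivity
  rw [entry_sub, entry_truncatedHopping hσ hp hφ, entry_truncatedHopping hσ hp hφ]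
  by_cases h1 : ‖i - j‖ ≤ 2 ^ n
  · have h2 : ‖i - j‖ ≤ 2 ^ (n + 1) :=
      h1.trans (pow_le_pow_right₀ (by norm_num) (Nat.le_succ n))
    rwa [if_pos h1, if_pos h2, sub_self, abs_zero]
  · rw [if_neg h1, sub_zero]
    by_cases h2 : ‖i - j‖ ≤ 2 ^ (n + 1)
    · rw [if_pos h2]
      refine (hφ _).trans ?_
      have hb := bracket_pos (i - j)
      have h3 : bracket (i - j) ^ (-(p - σ)) ≤ ((2 : ℝ) ^ (-(p - σ))) ^ n := by
        have hle : (2 : ℝ) ^ n ≤ bracket (i - j) := (not_le.mp h1).le.trans (norm_le_bracket _)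
        rw [← Real.rpow_natCast, ← Real.rpow_mul (by norm_num), mul_comm, Real.rpow_mul (by norm_num),
          Real.rpow_natCast]
        exact Real.rpow_le_rpow_of_nonpos (by positivity) hle (by linarith)
      calc ε * bracket (i - j) ^ (-p) =
            ε * (bracket (i - j) ^ (-σ) * bracket (i - j) ^ (-(p - σ))) := by
            rw [← Real.rpow_add hb]
            congr 2
            ring
        _ ≤ ε * ((kernelConst d σ * Real.exp 1 * kernel σ ((2 : ℝ)⁻¹ ^ (n + 1)) (i - j)) *
            ((2 : ℝ) ^ (-(p - σ))) ^ n) := by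
            gcongr
            exact bracket_rpow_le_kernel h2
        _ = _ := by ring
    · rwa [if_neg h2, abs_zero]

end Truncation

/-- The conjugation theorem: a small polynomially decaying Toeplitz matrix can be conjugated into
a distal diagonal after adding a suitable limit-periodic diagonal. -/
theorem exists_toeplitz_conjugation {d : ℕ} {σ τ p b c κ : ℝ} (hσ : (d : ℝ) < σ) (hτ : 0 ≤ τ)
    (hb : 0 ≤ b) (hp : σ + τ + b < p) (hc : 0 < c) (hκ : 0 < κ) :
    ∃ ε : ℝ, 0 < ε ∧ ∀ φ : Site d → ℝ, (∀ k, |φ k| ≤ ε * bracket k ^ (-p)) →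
      ∀ D : Site d → ℝ, IsDistal c τ D →
        ∃ S V Q : L2 ℝ d →L[ℝ] L2 ℝ d, (∀ i j, entry S i j = φ (i - j)) ∧
          (S + diagOp D + Q) * V = V * diagOp D ∧ (∀ i j, i ≠ j → entry Q i j = 0) ∧
          AlmostPeriodic (fun i => entry Q i i) ∧
          ∀ i j, |entry (V - 1) i j| ≤ κ * bracket (i - j) ^ (-(σ + b)) := by
  obtain ⟨C, hC1, hC⟩ := exists_rpow_mul_exp_le hτ
  obtain ⟨C', hC1', hC'⟩ := exists_rpow_mul_exp_le hb
  set θ : ℝ := 2 ^ (-(p - σ)) with hθ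
  have hθ0 : 0 < θ := by positivity
  have hθ1 : θ < 1 := Real.rpow_lt_one_of_one_lt_of_neg (by norm_num) (by linarith)
  have hr1 : θ * 2 ^ τ < 1 := by
    rw [hθ, ← Real.rpow_add (by norm_num)]
    exact Real.rpow_lt_one_of_one_lt_of_neg (by norm_num) (by linarith)
  have hr2 : θ * 2 ^ τ * 2 ^ b < 1 := by
    rw [hθ, ← Real.rpow_add (by norm_num), ← Real.rpow_add (by norm_num)]
    exact Real.rpow_lt_one_of_one_lt_of_neg (by norm_num) (by linarith)
  set r := θ * 2 ^ τ with hr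
  set K := kernelConst d σ * Real.exp 1 with hKdef
  have hK : 0 < K := mul_pos (kernelConst_pos d σ) (Real.exp_pos 1)
  have hC0 : 0 < C := by linarith
  have hC0' : 0 < C' := by linarith
  have hr1' : 0 < 1 - r := by linarith
  have hr2' : 0 < 1 - r * 2 ^ b := by linarith
  set x := min (θ * (1 - r) / 20) (κ * (1 - r * 2 ^ b) / (2 * C')) with hx
  have hx0 : 0 < x := lt_min (by positivity) (by positivity)
  have hx1 : x ≤ θ * (1 - r) / 20 := min_le_left _ _
  have hx2 : x ≤ κ * (1 - r * 2 ^ b) / (2 * C') := min_le_right _ _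
  set ε₁ := c * x / C with hε₁
  have hε₁0 : 0 < ε₁ := by positivity
  refine ⟨ε₁ * θ / (4 * K), by positivity, fun φ hφ D hD => ?_⟩
  set ε := ε₁ * θ / (4 * K) with hε
  have hε0 : 0 < ε := by positivity
  have hεK : 4 * (ε * K) = ε₁ * θ := by rw [hε]; field_simp
  have hσp : σ ≤ p := by linarith
  obtain ⟨S, V, Q, hS, h1, h2, h3, h4⟩ := exists_conjugation (μ := ε * K) hσ hc hC1 (hC d) hD
    hθ0 hθ1 hr hr1 hε₁0.le (by positivity) (x := x) (by rw [hε₁]; field_simp)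
    (T := truncatedHopping φ) (regular_truncatedHopping hσ hσp hε0.le hφ)
    (by
      have := dominated_truncatedHopping hσ hσp hε0.le hφ 0
      rw [pow_zero] at this
      refine this.mono hε₁0.le ?_ (fun k => (kernel_pos _ _ _).le) fun _ => le_rfl
      have : ε₁ * θ ≤ ε₁ * 1 := mul_le_mul_of_nonneg_left hθ1.le hε₁0.le
      have : 0 < ε * K := by positivity
      linarith)
    (dominated_truncatedHopping_sub hσ hσp hε0.le hφ)
    (by
      rw [div_le_iff₀ hr1']
      linarith) hεK.le hr2 (hC' d)
  refine ⟨S, V, Q, fun i j => ?_, h1, h2, h3, fun i j => (h4 i j).trans ?_⟩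
  · refine tendsto_nhds_unique (tendsto_entry hS i j) ?_
    obtain ⟨n, hn⟩ := pow_unbounded_of_one_lt ‖i - j‖ (one_lt_two : (1 : ℝ) < 2)
    refine tendsto_const_nhds.congr' ?_
    filter_upwards [eventually_ge_atTop n] with m hm
    rw [entry_truncatedHopping hσ hσp hφ, if_pos]
    exact hn.le.trans (pow_le_pow_right₀ (by norm_num) hm)
  · have hbr := bracket_pos (i - j)
    refine mul_le_mul_of_nonneg_right ?_ (by positivity)
    rw [div_le_iff₀ hr2']
    rw [le_div_iff₀ (by positivity)] at hx2
    linarith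

/-! ### Spectral consequences -/

section Spectrum

variable {d : ℕ}

lemma diagOp_unitVec {q : Site d → ℂ} {C : ℝ} (hq : ∀ i, ‖q i‖ ≤ C) (k : Site d) :
    diagOp q (unitVec ℂ k) = q k • unitVec ℂ k := by
  ext i
  rw [diagOp_apply hq, lp.coeFn_smul, Pi.smul_apply, unitVec_apply]
  by_cases h : i = k
  · subst h; simp
  · simp [h]

lemma unitVec_ne_zero (k : Site d) : unitVec ℂ k ≠ 0 := by
  rw [← norm_ne_zero_iff, norm_unitVec]
  exact one_ne_zero

lemma diagOp_mul_diagOp {q q' : Site d → ℂ} {C C' : ℝ} (hq : ∀ i, ‖q i‖ ≤ C)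
    (hq' : ∀ i, ‖q' i‖ ≤ C') (h : ∀ i, q i * q' i = 1) : diagOp q * diagOp q' = 1 := by
  refine operator_ext fun i j => ?_
  rw [entry_diagOp_mul hq, entry_diagOp hq', entry_one]
  split_ifs
  · exact h i
  · exact mul_zero _

lemma spectrum_diagOp {q : Site d → ℂ} {C : ℝ} (hq : ∀ i, ‖q i‖ ≤ C) :
    spectrum ℂ (diagOp q) = closure (Set.range q) := by
  apply subset_antisymm
  · intro z hz
    by_contra hzc
    apply hz
    obtain ⟨δ, hδ, hball⟩ := Metric.isOpen_iff.mp isClosed_closure.isOpen_compl z hzc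
    have hsep : ∀ i, δ ≤ ‖z - q i‖ := by
      intro i
      by_contra hlt
      refine hball (a := q i) ?_ (subset_closure ⟨i, rfl⟩)
      rw [Metric.mem_ball, dist_comm, dist_eq_norm]
      exact not_le.mp hlt
    have h1 : ∀ i, ‖z - q i‖ ≤ ‖z‖ + C := fun i =>
      (norm_sub_le _ _).trans (add_le_add_right (hq i) _)
    have h2 : ∀ i, ‖(z - q i)⁻¹‖ ≤ δ⁻¹ := fun i => by
      rw [norm_inv]
      exact inv_anti₀ hδ (hsep i)
    have hne : ∀ i, z - q i ≠ 0 := fun i => norm_pos_iff.mp (hδ.trans_le (hsep i))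
    have heq : algebraMap ℂ (L2 ℂ d →L[ℂ] L2 ℂ d) z - diagOp q = diagOp fun i => z - q i := by
      refine operator_ext fun i j => ?_
      rw [entry_sub, entry_diagOp hq, entry_diagOp h1, Algebra.algebraMap_eq_smul_one]
      have : entry (z • (1 : L2 ℂ d →L[ℂ] L2 ℂ d)) i j = z * if i = j then 1 else 0 := by
        rw [← entry_one]
        simp [entry]
      rw [this]
      split_ifs <;> simp
    rw [spectrum.mem_resolventSet_iff, heq]
    exact ⟨⟨_, _, diagOp_mul_diagOp h1 h2 fun i => mul_inv_cancel₀ (hne i),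
      diagOp_mul_diagOp h2 h1 fun i => inv_mul_cancel₀ (hne i)⟩, rfl⟩
  · refine closure_minimal ?_ (spectrum.isClosed _)
    rintro _ ⟨k, rfl⟩ hu
    obtain ⟨u, hu⟩ := hu
    have h0 : (u : L2 ℂ d →L[ℂ] L2 ℂ d) (unitVec ℂ k) = 0 := by
      rw [hu]
      simp [diagOp_unitVec hq, Algebra.algebraMap_eq_smul_one]
    have h1 : ((u⁻¹ * u : (L2 ℂ d →L[ℂ] L2 ℂ d)ˣ) : L2 ℂ d →L[ℂ] L2 ℂ d) (unitVec ℂ k) = 0 := by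
      rw [Units.val_mul, mul_apply_eq_comp, h0, map_zero]
    rw [inv_mul_cancel] at h1
    exact unitVec_ne_zero k h1

lemma entry_mul_ofReal {A B : L2 ℝ d →L[ℝ] L2 ℝ d} {A' B' : L2 ℂ d →L[ℂ] L2 ℂ d}
    (hA : ∀ i j, entry A' i j = ((entry A i j : ℝ) : ℂ)) (hB : ∀ i j, entry B' i j = ((entry B i j : ℝ) : ℂ))
    (i j : Site d) : entry (A' * B') i j = ((entry (A * B) i j : ℝ) : ℂ) := by
  refine (hasSum_entry_mul A' B' i j).unique ?_
  simp_rw [hA, hB, ← Complex.ofReal_mul]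
  exact Complex.hasSum_ofReal.mpr (hasSum_entry_mul A B i j)

lemma isPowerLawLocalized_of_conjugation {r : ℝ} {H V : L2 ℂ d →L[ℂ] L2 ℂ d} (hV : IsUnit V)
    {q : Site d → ℂ} {C : ℝ} (hq : ∀ i, ‖q i‖ ≤ C) (hHV : H * V = V * diagOp q)
    (hVr : ∀ i k, ‖entry V i k‖ ≤ 2 * bracket (i - k) ^ (-r)) : IsPowerLawLocalized r H := by
  obtain ⟨U, hU⟩ := hV
  have hinv : ∀ u, V ((U⁻¹ : (L2 ℂ d →L[ℂ] L2 ℂ d)ˣ).val u) = u := fun u => by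
    rw [← mul_apply_eq_comp, ← hU, Units.mul_inv]
    rfl
  have hinv' : ∀ u, (U⁻¹ : (L2 ℂ d →L[ℂ] L2 ℂ d)ˣ).val (V u) = u := fun u => by
    rw [← mul_apply_eq_comp, ← hU, Units.inv_mul]
    rfl
  have heig : ∀ k, Module.End.HasEigenvector (H : L2 ℂ d →ₗ[ℂ] L2 ℂ d) (q k)
      (V (unitVec ℂ k)) := by
    intro k
    refine ⟨Module.End.mem_eigenspace_iff.mpr ?_, fun h0 => ?_⟩
    · change H (V (unitVec ℂ k)) = _
      rw [← mul_apply_eq_comp, hHV, mul_apply_eq_comp, diagOp_unitVec hq,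
        map_smul]
    · apply unitVec_ne_zero k
      rw [← hinv' (unitVec ℂ k), h0, map_zero]
  have hdense : (Submodule.span ℂ
      (Set.range fun k => V (unitVec ℂ k))).topologicalClosure = ⊤ := by
    rw [Submodule.eq_top_iff']
    intro u
    have hs := V.hasSum (hasSum_unitVec ((U⁻¹ : (L2 ℂ d →L[ℂ] L2 ℂ d)ˣ).val u))
    rw [hinv] at hs
    refine (Submodule.isClosed_topologicalClosure _).mem_of_tendsto hs
      (Eventually.of_forall fun s => Submodule.le_topologicalClosure _
        (Submodule.sum_mem _ fun k _ => ?_))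
    rw [map_smul]
    exact Submodule.smul_mem _ _ (Submodule.subset_span ⟨k, rfl⟩)
  refine ⟨?_, fun k => V (unitVec ℂ k), ⟨fun k => ⟨q k, heig k⟩, hdense⟩, hVr⟩
  refine top_le_iff.mp (hdense.symm.le.trans (Submodule.topologicalClosure_mono
    (Submodule.span_mono ?_)))
  rintro _ ⟨k, rfl⟩
  exact ⟨q k, heig k⟩

lemma spectrum_of_conjugation {H V : L2 ℂ d →L[ℂ] L2 ℂ d} (hV : IsUnit V)
    {q : Site d → ℂ} {C : ℝ} (hq : ∀ i, ‖q i‖ ≤ C) (hHV : H * V = V * diagOp q) :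
    spectrum ℂ H = closure (Set.range q) := by
  obtain ⟨U, rfl⟩ := hV
  have : H = U * diagOp q * ((U⁻¹ : (L2 ℂ d →L[ℂ] L2 ℂ d)ˣ) : L2 ℂ d →L[ℂ] L2 ℂ d) := by
    rw [← hHV, Units.mul_inv_cancel_right]
  rw [this, spectrum.units_conjugate, spectrum_diagOp hq]

lemma closure_range_ofReal (D : Site d → ℝ) :
    closure (Set.range fun i => (D i : ℂ)) = Complex.ofReal '' closure (Set.range D) := by
  rw [← Complex.isometry_ofReal.isClosedEmbedding.closure_image_eq, ← Set.range_comp]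
  rfl

/-- A real conjugation to a diagonal yields a localized operator with prescribed spectrum. -/
theorem exists_localized_operator {φ D : Site d → ℝ} {p ε ς κ r : ℝ} (hp : (d : ℝ) < p)
    (hφ : ∀ k, |φ k| ≤ ε * bracket k ^ (-p)) (hD : ∀ i, |D i| ≤ 1)
    (hDap : AlmostPeriodic D) {S V Q : L2 ℝ d →L[ℝ] L2 ℝ d}
    (hS : ∀ i j, entry S i j = φ (i - j)) (hSV : (S + diagOp D + Q) * V = V * diagOp D)
    (hQ : ∀ i j, i ≠ j → entry Q i j = 0) (hQap : AlmostPeriodic fun i => entry Q i i)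
    (hς : (d : ℝ) < ς) (hr : r ≤ ς) (hκ1 : κ ≤ 1)
    (hκ : κ * ∑' k : Site d, bracket k ^ (-ς) ≤ 1 / 2)
    (hV : ∀ i j, |entry (V - 1) i j| ≤ κ * bracket (i - j) ^ (-ς)) :
    ∃ (d' : Site d → ℝ) (H : EllTwo d →L[ℂ] EllTwo d),
      (fun i => (d' i : ℂ)) ∈ limitPeriodic d ∧
      IsOperatorOf (hopping φ + Matrix.diagonal fun i => (d' i : ℂ)) H ∧
      IsPowerLawLocalized r H ∧ spectrum ℂ H = Complex.ofReal '' closure (Set.range D) := by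
  have hDn : ∀ i, ‖D i‖ ≤ 1 := hD
  have hDc : ∀ i, ‖(D i : ℂ)‖ ≤ 1 := fun i => by simpa using hD i
  set d' : Site d → ℝ := fun i => D i + entry Q i i with hd'
  set A : L2 ℝ d →L[ℝ] L2 ℝ d := S + diagOp D + Q with hA
  have hentryA : ∀ i j, (hopping φ + Matrix.diagonal fun i => (d' i : ℂ)) i j =
      ((entry A i j : ℝ) : ℂ) := by
    intro i j
    rw [hA, entry_add, entry_add, hS, entry_diagOp hDn, Matrix.add_apply, hopping, Matrix.of_apply]
    by_cases h : i = j
    · subst h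
      simp [hd', add_assoc]
    · simp [h, hQ i j h]
  have hAb : ∀ i j, ‖(hopping φ + Matrix.diagonal fun i => (d' i : ℂ)) i j‖ ≤
      ε * bracket (i - j) ^ (-p) + if i - j = 0 then 1 + ‖Q‖ else 0 := by
    intro i j
    rw [Matrix.add_apply]
    refine (norm_add_le _ _).trans (add_le_add ?_ ?_)
    · simpa [hopping] using hφ (i - j)
    · rw [Matrix.diagonal_apply]
      refine norm_ite_le_dirac (q := fun i => (d' i : ℂ)) (fun i => ?_) i j
      rw [Complex.norm_real]
      exact (norm_add_le _ _).trans (add_le_add (hDn i) (norm_entry_le Q i i))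
  have hHs : Summable fun k : Site d =>
      ε * bracket k ^ (-p) + if k = 0 then 1 + ‖Q‖ else 0 :=
    ((summable_bracket_rpow hp).mul_left ε).add (summable_dirac _)
  set H : L2 ℂ d →L[ℂ] L2 ℂ d :=
    ofEntries (hopping φ + Matrix.diagonal fun i => (d' i : ℂ)) with hH
  have hHe : ∀ i j, entry H i j = (hopping φ + Matrix.diagonal fun i => (d' i : ℂ)) i j :=
    entry_ofEntries hHs hAb
  have hςs : Summable fun k : Site d => κ * bracket k ^ (-ς) :=
    (summable_bracket_rpow hς).mul_left κ
  set W : L2 ℂ d →L[ℂ] L2 ℂ d := ofEntries fun i j => ((entry (V - 1) i j : ℝ) : ℂ) with hW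
  have hWe : ∀ i j, entry W i j = ((entry (V - 1) i j : ℝ) : ℂ) :=
    entry_ofEntries hςs fun i j => by
      rw [Complex.norm_real]
      exact hV i j
  have hWn : ‖W‖ < 1 := by
    have h := norm_le_tsum_of_entry_le (A := W) hςs fun i j => by
      rw [hWe, Complex.norm_real]
      exact hV i j
    rw [tsum_mul_left] at h
    linarith
  have hVe : ∀ i j, entry (1 + W) i j = ((entry V i j : ℝ) : ℂ) := by
    intro i j
    rw [entry_add, hWe, entry_sub, entry_one, entry_one]
    split_ifs <;> simp
  have hVu : IsUnit (1 + W) := by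
    have := isUnit_one_sub_of_norm_lt_one (x := -W) (by rwa [norm_neg])
    rwa [sub_neg_eq_add] at this
  have hDe : ∀ i j, entry (diagOp fun i => ((D i : ℝ) : ℂ)) i j = ((entry (diagOp D) i j : ℝ) : ℂ) := by
    intro i j
    rw [entry_diagOp hDc, entry_diagOp hDn]
    split_ifs <;> simp
  have hconj : H * (1 + W) = (1 + W) * diagOp (fun i => (D i : ℂ)) := by
    refine operator_ext fun i j => ?_
    rw [entry_mul_ofReal (fun i j => (hHe i j).trans (hentryA i j)) hVe,
      entry_mul_ofReal hVe hDe, hSV]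
  refine ⟨d', H, (hDap.add hQap).ofReal_mem_limitPeriodic, fun u i => ?_,
    isPowerLawLocalized_of_conjugation hVu hDc hconj fun i k => ?_, ?_⟩
  · have h := hasSum_entry H u i
    simp_rw [hHe] at h
    exact h
  · rw [hVe, Complex.norm_real]
    have h1 : entry V i k = entry (V - 1) i k + if i = k then 1 else 0 := by
      rw [entry_sub, entry_one]; ring
    have hbr := bracket_pos (i - k)
    have hle : bracket (i - k) ^ (-ς) ≤ bracket (i - k) ^ (-r) :=
      bracket_rpow_le_rpow _ (by linarith)
    have hpos : 0 < bracket (i - k) ^ (-r) := by positivity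
    rw [h1]
    refine (norm_add_le _ _).trans ?_
    have h2 : ‖entry (V - 1) i k‖ ≤ bracket (i - k) ^ (-r) :=
      (hV i k).trans ((mul_le_of_le_one_left (by positivity) hκ1).trans hle)
    have h3 : ‖if i = k then (1 : ℝ) else 0‖ ≤ bracket (i - k) ^ (-r) := by
      split_ifs with h
      · subst h
        simp
      · rw [norm_zero]
        exact hpos.le
    linarith
  · rw [spectrum_of_conjugation hVu hDc hconj, closure_range_ofReal]

end Spectrum

/-! ### Binary digits of lattice points -/

section Digits

/-- The `j`-th binary digit of an integer. -/
def bitAt (u : ℤ) (j : ℕ) : ℤ := u / 2 ^ j % 2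

lemma bitAt_eq_zero_or_one (u : ℤ) (j : ℕ) : bitAt u j = 0 ∨ bitAt u j = 1 :=
  Int.emod_two_eq_zero_or_one _

lemma emod_two_pow_succ (u : ℤ) (n : ℕ) : u % 2 ^ (n + 1) = u % 2 ^ n + 2 ^ n * bitAt u n := by
  unfold bitAt
  have h1 := Int.emod_add_mul_ediv u (2 ^ n)
  have h2 := Int.emod_add_mul_ediv (u / 2 ^ n) 2
  have h3 := Int.emod_add_mul_ediv u (2 ^ (n + 1))
  rw [Int.ediv_ediv_of_nonneg (by positivity), ← pow_succ] at h2
  linear_combination h3 - h1 - 2 ^ n * h2 - (u / 2 ^ (n + 1)) * pow_succ (2 : ℤ) n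

lemma bitAt_add_mul (u t : ℤ) {j n : ℕ} (h : j < n) : bitAt (u + 2 ^ n * t) j = bitAt u j := by
  obtain ⟨k, rfl⟩ := Nat.exists_eq_add_of_lt h
  unfold bitAt
  rw [show (2 : ℤ) ^ (j + k + 1) * t = 2 ^ j * (2 * (2 ^ k * t)) by ring,
    Int.add_mul_ediv_left _ _ (by positivity), Int.add_mul_emod_self_left]

lemma emod_eq_of_bitAt_eq {u v : ℤ} {n : ℕ} (h : ∀ j < n, bitAt u j = bitAt v j) :
    u % 2 ^ n = v % 2 ^ n := by
  induction n with
  | zero => simp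
  | succ n ih =>
    rw [emod_two_pow_succ, emod_two_pow_succ, ih fun j hj => h j (Nat.lt_succ_of_lt hj),
      h n (Nat.lt_succ_self n)]

lemma exists_bitAt_eq (t : ℕ → ℤ) (ht : ∀ j, t j = 0 ∨ t j = 1) (n : ℕ) :
    ∃ u : ℤ, ∀ j < n, bitAt u j = t j := by
  induction n generalizing t with
  | zero => exact ⟨0, by simp⟩
  | succ n ih =>
    obtain ⟨u, hu⟩ := ih (fun j => t (j + 1)) fun j => ht (j + 1)
    refine ⟨t 0 + 2 * u, fun j hj => ?_⟩
    cases j with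
    | zero =>
      simp only [bitAt, pow_zero, Int.ediv_one]
      rcases ht 0 with h | h <;> rw [h] <;> omega
    | succ j =>
      rw [← hu j (by omega)]
      unfold bitAt
      rw [pow_succ', ← Int.ediv_ediv_of_nonneg (by norm_num)]
      congr 2
      rcases ht 0 with h | h <;> rw [h] <;> omega

lemma abs_sub_ge_of_bitAt {u v : ℤ} {n : ℕ} (h : ∀ j < n, bitAt u j = bitAt v j) (hne : u ≠ v) :
    (2 : ℤ) ^ n ≤ |u - v| :=
  Int.le_of_dvd (abs_pos.mpr (sub_ne_zero.mpr hne))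
    ((dvd_abs _ _).mpr (Int.dvd_of_emod_eq_zero
      (Int.emod_eq_emod_iff_emod_sub_eq_zero.mp (emod_eq_of_bitAt_eq h))))

lemma abs_apply_le_norm {d : ℕ} (k : Site d) (l : Fin d) : ((|k l| : ℤ) : ℝ) ≤ ‖k‖ := by
  have := norm_le_pi_norm k l
  rwa [Int.norm_eq_abs, ← Int.cast_abs] at this

variable {d : ℕ} [NeZero d]

/-- The binary digits of a lattice point, the coordinates being interleaved. -/
def latticeBit (x : Site d) (m : ℕ) : ℤ := bitAt (x (Fin.ofNat d m)) (m / d)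

lemma latticeBit_eq_zero_or_one (x : Site d) (m : ℕ) : latticeBit x m = 0 ∨ latticeBit x m = 1 :=
  bitAt_eq_zero_or_one _ _

lemma latticeBit_mul_add (x : Site d) (l : Fin d) (j : ℕ) :
    latticeBit x (d * j + l) = bitAt (x l) j := by
  have h1 : Fin.ofNat d (d * j + l) = l := by
    ext
    simp [Nat.mod_eq_of_lt l.isLt]
  have h2 : (d * j + l) / d = j := by
    rw [Nat.mul_add_div (NeZero.pos d), Nat.div_eq_of_lt l.isLt, add_zero]
  rw [latticeBit, h1, h2]

lemma latticeBit_add_smul (x m : Site d) {n j : ℕ} (h : j < n) :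
    latticeBit (x + (2 ^ n : ℤ) • m) j = latticeBit x j := by
  unfold latticeBit
  simp only [Pi.add_apply, Pi.smul_apply, smul_eq_mul]
  exact bitAt_add_mul _ _ ((Nat.div_le_self j d).trans_lt h)

lemma exists_latticeBit_eq (t : ℕ → ℤ) (ht : ∀ j, t j = 0 ∨ t j = 1) (n : ℕ) :
    ∃ x : Site d, ∀ j < n, latticeBit x j = t j := by
  choose u hu using fun l : Fin d => exists_bitAt_eq (fun j => t (d * j + l)) (fun j => ht _) n
  refine ⟨u, fun j hj => ?_⟩
  have h := hu (Fin.ofNat d j) (j / d) ((Nat.div_le_self j d).trans_lt hj)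
  rw [latticeBit, h]
  congr 1
  simp [Nat.div_add_mod]

/-- The first position at which the digits of two lattice points differ. -/
lemma exists_first_difference {x y : Site d} (h : x ≠ y) :
    ∃ m, latticeBit x m ≠ latticeBit y m ∧ ∀ j < m, latticeBit x j = latticeBit y j := by
  have hex : ∃ m, latticeBit x m ≠ latticeBit y m := by
    by_contra! hall
    obtain ⟨l, hl⟩ := Function.ne_iff.mp h
    obtain ⟨n, hn⟩ := pow_unbounded_of_one_lt |x l - y l| (one_lt_two : (1 : ℤ) < 2)
    have := abs_sub_ge_of_bitAt (n := n) (fun j _ => by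
      rw [← latticeBit_mul_add, ← latticeBit_mul_add]
      exact hall _) hl
    omega
  classical
  exact ⟨Nat.find hex, Nat.find_spec hex, fun j hj => not_not.mp (Nat.find_min hex hj)⟩

/-- The digits below a position belong to smaller levels in each coordinate. -/
lemma bitAt_eq_below {x y : Site d} {m : ℕ} (h : ∀ j < m, latticeBit x j = latticeBit y j) :
    ∀ j < m / d, bitAt (x (Fin.ofNat d m)) j = bitAt (y (Fin.ofNat d m)) j := by
  intro j hj
  rw [← latticeBit_mul_add, ← latticeBit_mul_add]
  apply h
  have h1 := Nat.div_add_mod m d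
  have h2 : d * (j + 1) ≤ d * (m / d) := Nat.mul_le_mul_left d hj
  have h3 := NeZero.pos d
  simp only [Fin.val_ofNat]
  rw [mul_add, mul_one] at h2
  omega

end Digits

/-! ### Limit-periodic sequences from digit expansions -/

section Expansions

variable {d : ℕ} [NeZero d] {b : ℕ}

/-- The sequence obtained by reading the digits of a lattice point in base `b`. -/
def digitSequence (F : ℕ → ℤ → Fin b) (x : Site d) : ℝ :=
  Real.ofDigits fun m => F m (latticeBit x m)

lemma abs_digitSequence_le_one (F : ℕ → ℤ → Fin b) (x : Site d) : |digitSequence F x| ≤ 1 := by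
  rw [digitSequence, abs_of_nonneg (Real.ofDigits_nonneg _)]
  exact Real.ofDigits_le_one _

lemma exists_inv_pow_lt (hb : 1 < b) {ε : ℝ} (hε : 0 < ε) : ∃ n : ℕ, ((b : ℝ) ^ n)⁻¹ < ε := by
  obtain ⟨n, hn⟩ := exists_pow_lt_of_lt_one hε
    (inv_lt_one_of_one_lt₀ (by exact_mod_cast hb : (1 : ℝ) < b))
  exact ⟨n, by rwa [← inv_pow]⟩

lemma almostPeriodic_digitSequence (hb : 1 < b) (F : ℕ → ℤ → Fin b) :
    AlmostPeriodic (digitSequence F : Site d → ℝ) := by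
  rw [almostPeriodic_iff]
  intro ε hε
  obtain ⟨n, hn⟩ := exists_inv_pow_lt hb hε
  refine ⟨n, fun m i => (Real.abs_ofDigits_sub_ofDigits_le fun j hj => ?_).trans_lt hn⟩
  rw [latticeBit_add_smul i m hj]

lemma closure_range_digitSequence (hb : 1 < b) (F : ℕ → ℤ → Fin b) :
    closure (Set.range (digitSequence F : Site d → ℝ)) =
      Real.ofDigits '' {a : ℕ → Fin b | ∀ m, a m = F m 0 ∨ a m = F m 1} := by
  apply subset_antisymm
  · refine closure_minimal ?_ ?_
    · rintro _ ⟨x, rfl⟩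
      refine ⟨_, fun m => ?_, rfl⟩
      rcases latticeBit_eq_zero_or_one x m with h | h <;> simp [h]
    · refine (IsCompact.image (IsClosed.isCompact ?_) Real.continuous_ofDigits).isClosed
      rw [Set.ofPred_forall]
      refine isClosed_iInter fun m => ?_
      have h : IsClosed {c : Fin b | c = F m 0 ∨ c = F m 1} := isClosed_discrete _
      have h' : Continuous fun a : ℕ → Fin b => a m := continuous_apply m
      exact h.preimage h'
  · rintro _ ⟨a, ha, rfl⟩
    rw [Metric.mem_closure_iff]
    intro ε hε
    obtain ⟨n, hn⟩ := exists_inv_pow_lt hb hε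
    have ht : ∀ m, ∃ t : ℤ, (t = 0 ∨ t = 1) ∧ a m = F m t := fun m => by
      rcases ha m with h | h
      · exact ⟨0, Or.inl rfl, h⟩
      · exact ⟨1, Or.inr rfl, h⟩
    choose t ht1 ht2 using ht
    obtain ⟨x, hx⟩ := exists_latticeBit_eq (d := d) t ht1 n
    refine ⟨_, ⟨x, rfl⟩, ?_⟩
    rw [Real.dist_eq]
    refine (Real.abs_ofDigits_sub_ofDigits_le fun j hj => ?_).trans_lt hn
    rw [hx j hj]
    exact ht2 j

lemma ofDigits_sub_ofDigits {a a' : ℕ → Fin b} {m : ℕ} (h : ∀ j < m, a j = a' j) :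
    Real.ofDigits a - Real.ofDigits a' = ((b : ℝ) ^ (m + 1))⁻¹ *
      ((((a m : ℕ) : ℝ) - (a' m : ℕ)) + (Real.ofDigits (fun i => a (i + (m + 1))) -
        Real.ofDigits fun i => a' (i + (m + 1)))) := by
  rw [Real.ofDigits_eq_sum_add_ofDigits a (m + 1), Real.ofDigits_eq_sum_add_ofDigits a' (m + 1),
    Finset.sum_range_succ, Finset.sum_range_succ]
  have : ∑ i ∈ Finset.range m, Real.ofDigitsTerm a i =
      ∑ i ∈ Finset.range m, Real.ofDigitsTerm a' i :=
    Finset.sum_congr rfl fun i hi => by simp [Real.ofDigitsTerm, h i (Finset.mem_range.mp hi)]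
  rw [this]
  simp only [Real.ofDigitsTerm]
  ring

end Expansions

section Examples

variable {d : ℕ}

/-! ### A distal sequence with values in the Cantor set -/

/-- Digits `0`, `2` in base three. -/
def cantorDigit (_ : ℕ) (t : ℤ) : Fin 3 := if t = 0 then 0 else 2

lemma isDistal_cantor (d : ℕ) [NeZero d] :
    IsDistal (((3 : ℝ) ^ d)⁻¹) (Real.logb 2 3 * d)
      (digitSequence cantorDigit : Site d → ℝ) := by
  refine ⟨almostPeriodic_digitSequence (by norm_num) _, abs_digitSequence_le_one _,
    fun x y hxy => ?_⟩
  obtain ⟨m, hm, hlt⟩ := exists_first_difference hxy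
  set l : Fin d := Fin.ofNat d m
  have hne : x l ≠ y l := fun h => hm (by rw [latticeBit, latticeBit, h])
  have hnorm : (2 : ℝ) ^ (m / d) ≤ bracket (x - y) := by
    have h1 := abs_sub_ge_of_bitAt (bitAt_eq_below hlt) hne
    have h2 := abs_apply_le_norm (x - y) l
    have h3 : ((2 : ℤ) ^ (m / d) : ℤ) ≤ |(x - y) l| := h1
    have h4 : (((2 : ℤ) ^ (m / d) : ℤ) : ℝ) ≤ ((|(x - y) l| : ℤ) : ℝ) := by exact_mod_cast h3
    push_cast at h4 h2
    exact (h4.trans h2).trans (norm_le_bracket _)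
  have hb := bracket_pos (x - y)
  have hτ : 0 ≤ Real.logb 2 3 := Real.logb_nonneg (by norm_num) (by norm_num)
  have hpow : ((3 : ℝ) ^ d) ^ (m / d) ≤ bracket (x - y) ^ (Real.logb 2 3 * d) := by
    calc ((3 : ℝ) ^ d) ^ (m / d) = ((2 : ℝ) ^ (m / d)) ^ (Real.logb 2 3 * d) := by
          rw [Real.rpow_mul (by positivity), ← Real.rpow_pow_comm (by norm_num),
            Real.rpow_logb (by norm_num) (by norm_num) (by norm_num), Real.rpow_natCast,
            pow_right_comm]
      _ ≤ _ := Real.rpow_le_rpow (by positivity) hnorm (by positivity)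
  have hlow : ((3 : ℝ) ^ (m + 1))⁻¹ ≤ |digitSequence cantorDigit x - digitSequence cantorDigit y| := by
    rw [digitSequence, digitSequence,
      ofDigits_sub_ofDigits (m := m) fun j hj => by rw [hlt j hj], abs_mul, abs_of_pos (by positivity)]
    refine le_mul_of_one_le_right (by positivity) ?_
    have h1 := Real.ofDigits_nonneg fun i => cantorDigit (i + (m + 1)) (latticeBit x (i + (m + 1)))
    have h2 := Real.ofDigits_le_one fun i => cantorDigit (i + (m + 1)) (latticeBit x (i + (m + 1)))
    have h3 := Real.ofDigits_nonneg fun i => cantorDigit (i + (m + 1)) (latticeBit y (i + (m + 1)))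
    have h4 := Real.ofDigits_le_one fun i => cantorDigit (i + (m + 1)) (latticeBit y (i + (m + 1)))
    generalize Real.ofDigits (fun i => cantorDigit (i + (m + 1)) _) = R at h1 h2 ⊢
    generalize Real.ofDigits (fun i => cantorDigit (i + (m + 1)) _) = R' at h3 h4 ⊢
    rw [le_abs]
    rcases latticeBit_eq_zero_or_one x m with hx | hx <;>
      rcases latticeBit_eq_zero_or_one y m with hy | hy
    · exact absurd (hx.trans hy.symm) hm
    · right
      simp only [hx, hy, cantorDigit]
      norm_num
      linarith
    · left
      simp only [hx, hy, cantorDigit]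
      norm_num
      linarith
    · exact absurd (hx.trans hy.symm) hm
  refine le_trans ?_ hlow
  rw [Real.rpow_neg hb.le, ← mul_inv]
  refine inv_anti₀ (by positivity) ?_
  calc (3 : ℝ) ^ (m + 1) ≤ 3 ^ (d + d * (m / d)) := by
        refine pow_le_pow_right₀ (by norm_num) ?_
        have h1 := Nat.div_add_mod m d
        have h2 := Nat.mod_lt m (NeZero.pos d)
        omega
    _ = 3 ^ d * ((3 : ℝ) ^ d) ^ (m / d) := by rw [pow_add, pow_mul]
    _ ≤ _ := by gcongr

lemma closure_range_cantor (d : ℕ) [NeZero d] :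
    closure (Set.range (digitSequence cantorDigit : Site d → ℝ)) = cantorSet := by
  rw [closure_range_digitSequence (by norm_num), cantorSet_eq_zero_two_ofDigits]
  ext x
  simp only [Set.mem_image, Set.mem_ofPred_eq]
  refine exists_congr fun a => and_congr_left fun _ => forall_congr' fun m => ?_
  simp only [cantorDigit]
  generalize a m = c
  revert c
  decide

lemma volume_cantorSet : volume cantorSet = 0 := by
  have hfin : volume cantorSet ≠ ∞ := isCompact_cantorSet.measure_lt_top.ne
  have h1 : (fun x : ℝ => x / 3) = AffineMap.homothety (0 : ℝ) (1 / 3 : ℝ) := by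
    ext x
    simp [AffineMap.homothety_apply]
    ring
  have h2 : (fun x : ℝ => (2 + x) / 3) = AffineMap.homothety (1 : ℝ) (1 / 3 : ℝ) := by
    ext x
    simp [AffineMap.homothety_apply]
    ring
  have h := congrArg volume cantorSet_eq_union_halves
  have hle := h.le.trans (measure_union_le _ _)
  rw [h1, h2, Measure.addHaar_image_homothety, Measure.addHaar_image_homothety,
    Module.finrank_self, pow_one, ← add_mul, ← ENNReal.ofReal_add (by positivity) (by positivity)]
    at hle
  have hr := ENNReal.toReal_mono (ENNReal.mul_ne_top ENNReal.ofReal_ne_top hfin) hle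
  rw [ENNReal.toReal_mul, ENNReal.toReal_ofReal (by positivity)] at hr
  have h0 : 0 ≤ (volume cantorSet).toReal := ENNReal.toReal_nonneg
  rw [abs_of_pos (by norm_num)] at hr
  have : (volume cantorSet).toReal = 0 := by linarith
  exact ((ENNReal.toReal_eq_zero_iff _).mp this).resolve_right hfin

lemma isCantorSet_cantorSet : IsCantorSet cantorSet := by
  refine ⟨⟨0, zero_mem_cantorSet⟩, isCompact_cantorSet, ?_, ⟨isClosed_cantorSet, ?_⟩⟩
  · have key : ∀ t ⊆ cantorSet, IsPreconnected t → ∀ x ∈ t, ∀ y ∈ t, ¬ x < y := by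
      intro t ht htp x hx y hy hlt
      have h := measure_mono (μ := volume) ((htp.Icc_subset hx hy).trans ht)
      rw [volume_cantorSet, Real.volume_Icc, nonpos_iff_eq_zero, ENNReal.ofReal_eq_zero] at h
      linarith
    intro t ht htp x hx y hy
    exact le_antisymm (not_lt.mp (key t ht htp y hy x hx)) (not_lt.mp (key t ht htp x hx y hy))
  · intro x hx
    rw [accPt_iff_nhds]
    intro U hU
    obtain ⟨ε, hε, hball⟩ := Metric.mem_nhds_iff.mp hU
    rw [cantorSet_eq_zero_two_ofDigits] at hx
    obtain ⟨a, ha, rfl⟩ := hx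
    obtain ⟨n, hn⟩ := exists_inv_pow_lt (b := 3) (by norm_num) hε
    let a' : ℕ → Fin 3 := Function.update a n (2 - a n)
    have ha' : ∀ i, a' i ≠ 1 := by
      intro i
      by_cases h : i = n
      · subst h
        have := ha i
        simp only [a', Function.update_self]
        generalize a i = c at this
        revert c
        decide
      · simpa [a', Function.update_of_ne h] using ha i
    have hne : a' n ≠ a n := by
      have := ha n
      simp only [a', Function.update_self]
      generalize a n = c at this
      revert c
      decide
    refine ⟨Real.ofDigits a', ⟨hball ?_, ?_⟩, fun h => hne ?_⟩
    · rw [Metric.mem_ball, Real.dist_eq]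
      refine (Real.abs_ofDigits_sub_ofDigits_le fun i hi => ?_).trans_lt hn
      simp [a', Function.update_of_ne hi.ne]
    · rw [cantorSet_eq_zero_two_ofDigits]
      exact ⟨a', ha', rfl⟩
    · exact congrFun (ofDigits_zero_two_sequence_unique ha' ha h) n

/-! ### A distal sequence which is dense in the unit interval -/

/-- Binary digits, flipped on every other level of the lattice. -/
def alternatingDigit (d m : ℕ) (t : ℤ) : Fin 2 := if (t + (m / d : ℕ)) % 2 = 0 then 0 else 1

lemma closure_range_alternating (d : ℕ) [NeZero d] :
    closure (Set.range (digitSequence (alternatingDigit d) : Site d → ℝ)) = Set.Icc 0 1 := by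
  rw [closure_range_digitSequence (by norm_num)]
  have : {a : ℕ → Fin 2 | ∀ m, a m = alternatingDigit d m 0 ∨ a m = alternatingDigit d m 1} =
      Set.univ := by
    refine Set.eq_univ_of_forall fun a m => ?_
    simp only [alternatingDigit]
    generalize a m = c
    rcases Int.emod_two_eq_zero_or_one ((m / d : ℕ) : ℤ) with h | h
    · have h1 : ((1 : ℤ) + (m / d : ℕ)) % 2 = 1 := by omega
      rw [zero_add, h, h1]
      revert c
      decide
    · have h1 : ((1 : ℤ) + (m / d : ℕ)) % 2 = 0 := by omega
      rw [zero_add, h, h1]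
      revert c
      decide
  rw [this]
  refine subset_antisymm ?_ (Real.ofDigits_SurjOn (by norm_num))
  rintro _ ⟨a, -, rfl⟩
  exact ⟨Real.ofDigits_nonneg _, Real.ofDigits_le_one _⟩

/-- A run of opposite alternating digits after the first difference forces two integers
to be far apart. -/
lemma abs_sub_ge_of_alternating {u v : ℤ} {n J : ℕ} {e : ℤ} (he : e = 1 ∨ e = -1)
    (hlt : ∀ j < n, bitAt u j = bitAt v j) (hn : bitAt u n - bitAt v n = e)
    (hJ : ∀ j < J, bitAt u (n + 1 + j) - bitAt v (n + 1 + j) = e * (-1) ^ j) :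
    (2 : ℤ) ^ (n + J) ≤ 4 * |u - v| := by
  have key : ∀ i ≤ J, 3 * (u % 2 ^ (n + 1 + i) - v % 2 ^ (n + 1 + i)) =
      e * 2 ^ n * (5 + (-2) ^ (i + 1)) := by
    intro i
    induction i with
    | zero =>
      intro _
      rw [add_zero, emod_two_pow_succ, emod_two_pow_succ, emod_eq_of_bitAt_eq hlt]
      linear_combination 3 * 2 ^ n * hn
    | succ i ih =>
      intro hi
      rw [← add_assoc, emod_two_pow_succ, emod_two_pow_succ]
      have h1 := ih (by omega)
      have h2 := hJ i (by omega)
      have h3 : (2 : ℤ) ^ i * (-1) ^ i = (-2) ^ i := by rw [← mul_pow]; norm_num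
      have h4 : (2 : ℤ) ^ (n + 1 + i) = 2 * 2 ^ n * 2 ^ i := by ring
      rw [pow_succ (-2 : ℤ) (i + 1), pow_succ (-2 : ℤ) i]
      rw [pow_succ (-2 : ℤ) i] at h1
      linear_combination h1 + 3 * 2 ^ (n + 1 + i) * h2 + 3 * e * (-1) ^ i * h4 +
        6 * e * 2 ^ n * h3
  have h3 := key J le_rfl
  have hu := Int.emod_add_mul_ediv u (2 ^ (n + 1 + J))
  have hv := Int.emod_add_mul_ediv v (2 ^ (n + 1 + J))
  obtain ⟨w, s, hw, hws⟩ : ∃ w s : ℤ, 3 * (u - v) = 2 ^ n * w ∧ w = 5 * e + 2 ^ (J + 1) * s := by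
    refine ⟨_, e * (-1) ^ (J + 1) +
      3 * (u / 2 ^ (n + 1 + J) - v / 2 ^ (n + 1 + J)), ?_, rfl⟩
    have h5 : (2 : ℤ) ^ (J + 1) * (-1) ^ (J + 1) = (-2) ^ (J + 1) := by
      rw [← mul_pow]; norm_num
    have h4 : (2 : ℤ) ^ (n + 1 + J) = 2 ^ n * 2 ^ (J + 1) := by ring
    linear_combination h3 - 3 * hu + 3 * hv - 2 ^ n * e * h5 +
      3 * (u / 2 ^ (n + 1 + J) - v / 2 ^ (n + 1 + J)) * h4
  have h3w : (3 : ℤ) ∣ w := by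
    have : (3 : ℤ) ∣ 2 ^ n * w := ⟨_, hw.symm⟩
    refine IsCoprime.dvd_of_dvd_mul_left ?_ this
    exact IsCoprime.pow_right (by norm_num)
  have hbound : 3 * (2 : ℤ) ^ J ≤ 4 * |w| := by
    have hs : s ≠ 0 := by
      rintro rfl
      rcases he with h | h <;> rw [h] at hws <;> omega
    have hs1 : (1 : ℤ) ≤ |s| := Int.one_le_abs hs
    have hw1 : (2 : ℤ) ^ (J + 1) - 5 ≤ |w| := by
      have h1 : |(2 : ℤ) ^ (J + 1) * s| ≤ |w| + |5 * e| := by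
        rw [show (2 : ℤ) ^ (J + 1) * s = w - 5 * e by linear_combination -hws]
        exact abs_sub _ _
      have h2 : |5 * e| = 5 := by rcases he with h | h <;> rw [h] <;> norm_num
      rw [h2, abs_mul, abs_of_pos (by positivity)] at h1
      nlinarith [pow_pos (two_pos : (0 : ℤ) < 2) (J + 1)]
    have hw0 : w ≠ 0 := by
      rintro rfl
      have hd : (2 : ℤ) ∣ 5 * e := ⟨-(2 ^ J * s), by linear_combination -hws⟩
      rcases he with h | h <;> rw [h] at hd <;> omega
    have hw3 : 3 ≤ |w| := Int.le_of_dvd (abs_pos.mpr hw0) ((dvd_abs _ _).mpr h3w)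
    have hp : (2 : ℤ) ^ (J + 1) = 2 * 2 ^ J := pow_succ' 2 J
    rw [hp] at hw1
    omega
  have habs : 3 * |u - v| = 2 ^ n * |w| := by
    have := congrArg abs hw
    rwa [abs_mul, abs_mul, abs_of_pos (by norm_num : (0 : ℤ) < 3),
      abs_of_pos (by positivity : (0 : ℤ) < 2 ^ n)] at this
  have h2n : (0 : ℤ) < 2 ^ n := by positivity
  rw [pow_add]
  nlinarith [mul_le_mul_of_nonneg_left hbound h2n.le]

end Examples

section Alternating

variable {d : ℕ}

lemma alternatingDigit_sub {m : ℕ} {t t' : ℤ} (ht : t = 0 ∨ t = 1) (ht' : t' = 0 ∨ t' = 1)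
    (h : alternatingDigit d m t = 0) (h' : alternatingDigit d m t' = 1) :
    t - t' = -(-1) ^ (m / d) := by
  unfold alternatingDigit at h h'
  have h1 : (t + (m / d : ℕ)) % 2 = 0 := by
    by_contra hne
    rw [if_neg hne] at h
    exact absurd h (by decide)
  have h2 : (t' + (m / d : ℕ)) % 2 ≠ 0 := by
    intro he
    rw [if_pos he] at h'
    exact absurd h' (by decide)
  rcases Nat.even_or_odd (m / d) with hev | hodd
  · rw [hev.neg_one_pow]
    obtain ⟨k, hk⟩ := hev
    rw [hk] at h1 h2
    push_cast at h1 h2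
    omega
  · rw [hodd.neg_one_pow]
    obtain ⟨k, hk⟩ := hodd
    rw [hk] at h1 h2
    push_cast at h1 h2
    omega

lemma inv_pow_le_ofDigits {a : ℕ → Fin 2} {i : ℕ} (h : a i = 1) :
    ((2 : ℝ) ^ (i + 1))⁻¹ ≤ Real.ofDigits a := by
  have := Real.summable_ofDigitsTerm.le_tsum (f := Real.ofDigitsTerm a) i
    fun j _ => Real.ofDigitsTerm_nonneg
  refine le_trans (le_of_eq ?_) this
  simp [Real.ofDigitsTerm, h]

lemma ofDigits_add_ofDigits_compl (a : ℕ → Fin 2) :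
    Real.ofDigits a + Real.ofDigits (fun i => 1 - a i) = 1 := by
  rw [← Real.ofDigits_const_last_eq_one 1, Real.ofDigits, Real.ofDigits, Real.ofDigits,
    ← Real.summable_ofDigitsTerm.tsum_add Real.summable_ofDigitsTerm]
  refine tsum_congr fun i => ?_
  have h : ∀ c : Fin 2, ((c : ℕ) : ℝ) + ((1 - c : Fin 2) : ℕ) = ((Fin.last 1 : ℕ) : ℝ) := by
    intro c
    fin_cases c <;> simp
  simp only [Real.ofDigitsTerm]
  rw [← add_mul, h]

lemma inv_le_abs_digitSequence_sub [NeZero d] {x y : Site d} {m : ℕ}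
    (hlt : ∀ j < m, latticeBit x j = latticeBit y j)
    (hx : alternatingDigit d m (latticeBit x m) = 1)
    (hy : alternatingDigit d m (latticeBit y m) = 0) :
    ((16 : ℝ) ^ d * bracket (x - y) ^ d)⁻¹ ≤
      |digitSequence (alternatingDigit d) x - digitSequence (alternatingDigit d) y| := by
  set l : Fin d := Fin.ofNat d m with hl
  set n := m / d with hn
  have hdpos := NeZero.pos d
  have hdm := Nat.div_add_mod m d
  have hpos : ∀ j, m + d * (j + 1) = d * (n + 1 + j) + l := by
    intro j
    simp only [hl, Fin.val_ofNat]
    rw [← hn] at hdm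
    linarith [mul_add d (n + 1) j, mul_add d n 1, mul_add d j 1]
  have hlev : ∀ j, (m + d * (j + 1)) / d = n + 1 + j := fun j => by
    rw [Nat.add_mul_div_left _ _ hdpos, ← hn]
    ring
  set a : ℕ → Fin 2 := fun i => alternatingDigit d i (latticeBit x i) with ha
  set a' : ℕ → Fin 2 := fun i => alternatingDigit d i (latticeBit y i) with ha'
  have hfar : ∀ J, (∀ j < J, a (m + d * (j + 1)) = 0 ∧ a' (m + d * (j + 1)) = 1) →
      (2 : ℤ) ^ (n + J) ≤ 4 * |x l - y l| := by
    intro J hJ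
    refine abs_sub_ge_of_alternating (e := (-1) ^ n) (neg_one_pow_eq_or ℤ n) (bitAt_eq_below hlt)
      ?_ fun j hj => ?_
    · have := alternatingDigit_sub (latticeBit_eq_zero_or_one y m)
        (latticeBit_eq_zero_or_one x m) hy hx
      rw [← hn] at this
      change latticeBit x m - latticeBit y m = _
      linarith
    · have h1 := alternatingDigit_sub (latticeBit_eq_zero_or_one x _)
        (latticeBit_eq_zero_or_one y _) (hJ j hj).1 (hJ j hj).2
      rw [hlev, hpos, latticeBit_mul_add, latticeBit_mul_add] at h1
      rw [h1]
      ring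
  have hex : ∃ J, ¬(a (m + d * (J + 1)) = 0 ∧ a' (m + d * (J + 1)) = 1) := by
    by_contra! hall
    obtain ⟨J, hJ⟩ := pow_unbounded_of_one_lt (4 * |x l - y l|) (one_lt_two : (1 : ℤ) < 2)
    have h1 := hfar J fun j _ => hall j
    have h2 : (2 : ℤ) ^ J ≤ 2 ^ (n + J) := pow_le_pow_right₀ (by norm_num) (Nat.le_add_left J n)
    linarith
  classical
  obtain ⟨J, hJ, hJlt⟩ : ∃ J, ¬(a (m + d * (J + 1)) = 0 ∧ a' (m + d * (J + 1)) = 1) ∧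
      ∀ j < J, a (m + d * (j + 1)) = 0 ∧ a' (m + d * (j + 1)) = 1 :=
    ⟨Nat.find hex, Nat.find_spec hex, fun j hj => not_not.mp (Nat.find_min hex hj)⟩
  have hB : (2 : ℝ) ^ (n + J) ≤ 4 * bracket (x - y) := by
    have h1 := hfar J hJlt
    have h2 := (abs_apply_le_norm (x - y) l).trans (norm_le_bracket _)
    have h3 : (((2 : ℤ) ^ (n + J) : ℤ) : ℝ) ≤ ((4 * |(x - y) l| : ℤ) : ℝ) := by exact_mod_cast h1
    push_cast at h2 h3
    linarith
  have hb := bracket_pos (x - y)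
  have hidx : d * (J + 1) - 1 + (m + 1) = m + d * (J + 1) := by
    have : 1 ≤ d * (J + 1) := Nat.mul_pos hdpos (Nat.succ_pos J)
    omega
  have hidx' : d * (J + 1) - 1 + 1 = d * (J + 1) :=
    Nat.sub_add_cancel (Nat.mul_pos hdpos (Nat.succ_pos J))
  have hgap : ((2 : ℝ) ^ (d * (J + 1)))⁻¹ ≤ 1 + (Real.ofDigits (fun i => a (i + (m + 1))) -
      Real.ofDigits fun i => a' (i + (m + 1))) := by
    have hfin : ∀ c : Fin 2, c ≠ 0 → c = 1 := by decide
    have hfin' : ∀ c : Fin 2, c ≠ 1 → 1 - c = 1 := by decide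
    by_cases h0 : a (m + d * (J + 1)) = 0
    · have h1 : a' (m + d * (J + 1)) ≠ 1 := fun h => hJ ⟨h0, h⟩
      have h2 := inv_pow_le_ofDigits (a := fun i => 1 - a' (i + (m + 1)))
        (i := d * (J + 1) - 1) (by
          simp only [hidx]
          exact hfin' _ h1)
      rw [hidx'] at h2
      have h3 := ofDigits_add_ofDigits_compl fun i => a' (i + (m + 1))
      have h4 := Real.ofDigits_nonneg fun i => a (i + (m + 1))
      linarith
    · have h2 := inv_pow_le_ofDigits (a := fun i => a (i + (m + 1)))
        (i := d * (J + 1) - 1) (by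
          simp only [hidx]
          exact hfin _ h0)
      rw [hidx'] at h2
      have h4 := Real.ofDigits_le_one fun i => a' (i + (m + 1))
      linarith
  have hdiff : digitSequence (alternatingDigit d) x - digitSequence (alternatingDigit d) y =
      ((2 : ℝ) ^ (m + 1))⁻¹ * (1 + (Real.ofDigits (fun i => a (i + (m + 1))) -
        Real.ofDigits fun i => a' (i + (m + 1)))) := by
    rw [digitSequence, digitSequence,
      ofDigits_sub_ofDigits (m := m) fun j hj => by rw [hlt j hj], hx, hy]
    simp [ha, ha']
  have hle := mul_le_mul_of_nonneg_left hgap (by positivity : (0 : ℝ) ≤ ((2 : ℝ) ^ (m + 1))⁻¹)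
  rw [← hdiff] at hle
  refine le_trans ?_ (hle.trans (le_abs_self _))
  rw [← mul_inv, ← pow_add]
  refine inv_anti₀ (by positivity) ?_
  calc (2 : ℝ) ^ (m + 1 + d * (J + 1)) ≤ 2 ^ ((n + J) * d + 2 * d) := by
        refine pow_le_pow_right₀ (by norm_num) ?_
        have h2 := Nat.mod_lt m hdpos
        rw [← hn] at hdm
        nlinarith
    _ = (2 ^ (n + J)) ^ d * 4 ^ d := by
        rw [pow_add, pow_mul, pow_mul]
        norm_num
    _ ≤ (4 * bracket (x - y)) ^ d * 4 ^ d := by gcongr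
    _ = 16 ^ d * bracket (x - y) ^ d := by
        rw [mul_pow, show (16 : ℝ) = 4 * 4 by norm_num, mul_pow]
        ring

lemma isDistal_alternating (d : ℕ) [NeZero d] :
    IsDistal (((16 : ℝ) ^ d)⁻¹) (Real.logb 2 3 * d)
      (digitSequence (alternatingDigit d) : Site d → ℝ) := by
  refine ⟨almostPeriodic_digitSequence (by norm_num) _, abs_digitSequence_le_one _,
    fun x y hxy => ?_⟩
  have hb := bracket_pos (x - y)
  have hlog : (1 : ℝ) ≤ Real.logb 2 3 := by
    rw [Real.le_logb_iff_rpow_le (by norm_num) (by norm_num)]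
    norm_num
  have hmain : ((16 : ℝ) ^ d * bracket (x - y) ^ d)⁻¹ ≤
      |digitSequence (alternatingDigit d) x - digitSequence (alternatingDigit d) y| := by
    obtain ⟨m, hm, hlt⟩ := exists_first_difference hxy
    have hcases : ∀ c : Fin 2, c = 0 ∨ c = 1 := by decide
    have hinj : ∀ t t' : ℤ, (t = 0 ∨ t = 1) → (t' = 0 ∨ t' = 1) →
        alternatingDigit d m t = alternatingDigit d m t' → t = t' := by
      intro t t' ht ht' h
      unfold alternatingDigit at h
      split_ifs at h with h1 h2 h2
      · omega
      · exact absurd h (by decide)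
      · exact absurd h (by decide)
      · omega
    rcases hcases (alternatingDigit d m (latticeBit x m)) with hx | hx <;>
      rcases hcases (alternatingDigit d m (latticeBit y m)) with hy | hy
    · exact absurd (hinj _ _ (latticeBit_eq_zero_or_one x m) (latticeBit_eq_zero_or_one y m)
        (hx.trans hy.symm)) hm
    · have := inv_le_abs_digitSequence_sub (fun j hj => (hlt j hj).symm) hy hx
      rwa [← neg_sub x y, bracket_neg, abs_sub_comm] at this
    · exact inv_le_abs_digitSequence_sub hlt hx hy
    · exact absurd (hinj _ _ (latticeBit_eq_zero_or_one x m) (latticeBit_eq_zero_or_one y m)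
        (hx.trans hy.symm)) hm
  refine le_trans ?_ hmain
  rw [Real.rpow_neg hb.le, ← mul_inv]
  refine inv_anti₀ (by positivity) (mul_le_mul_of_nonneg_left ?_ (by positivity))
  rw [← Real.rpow_natCast]
  exact bracket_rpow_le_rpow _ (le_mul_of_one_le_left (Nat.cast_nonneg d) hlog)

end Alternating

/-! ### The decay of the hopping terms -/

section Hopping

variable {d : ℕ}

lemma abs_le_of_sobolevNorm_le {φ : Site d → ℝ} {s ε : ℝ} (hε : 0 ≤ ε)
    (h : sobolevNorm s (hopping φ) ≤ ENNReal.ofReal ε) (k : Site d) :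
    |φ k| * bracket k ^ s ≤ ε := by
  have hb := bracket_pos k
  have hsup : ∀ k : Site d, (⨆ i : Site d, ‖hopping φ i (i - k)‖ₑ) = ENNReal.ofReal |φ k| := by
    intro k
    simp only [hopping, Matrix.of_apply, sub_sub_cancel, ciSup_const]
    rw [← ofReal_norm, Complex.norm_real, Real.norm_eq_abs]
  have hterm : ENNReal.ofReal ((|φ k| * bracket k ^ s) ^ 2) ≤
      ∑' k : Site d, (⨆ i : Site d, ‖hopping φ i (i - k)‖ₑ) ^ 2 *
        ENNReal.ofReal (bracket k ^ (2 * s)) := by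
    refine le_trans (le_of_eq ?_) (ENNReal.le_tsum k)
    rw [hsup, ← ENNReal.ofReal_pow (abs_nonneg _), ← ENNReal.ofReal_mul (by positivity), mul_pow,
      mul_comm 2 s, Real.rpow_mul hb.le, Real.rpow_two]
  have h1 := (ENNReal.rpow_le_rpow hterm (by norm_num : (0 : ℝ) ≤ 1 / 2)).trans h
  rw [ENNReal.ofReal_rpow_of_nonneg (by positivity) (by norm_num), ← Real.sqrt_eq_rpow,
    Real.sqrt_sq (by positivity)] at h1
  exact (ENNReal.ofReal_le_ofReal_iff hε).mp h1

lemma abs_le_of_interpolation {φ : Site d → ℝ} {s s' t p ε : ℝ} (hε : 0 < ε) (ht0 : 0 < t)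
    (ht1 : t ≤ 1) (hp : p = s * (1 - t) + s' * t) (h0 : φ 0 = 0)
    (hφ : ∀ k, k ≠ 0 → |φ k| ≤ ‖k‖ ^ (-s))
    (hφ' : ∀ k, |φ k| * bracket k ^ s' ≤ ε ^ (1 / t)) (k : Site d) :
    |φ k| ≤ ε * bracket k ^ (-p) := by
  have hb := bracket_pos k
  by_cases hk : k = 0
  · subst hk
    rw [h0, abs_zero]
    positivity
  · have h1 : |φ k| ≤ bracket k ^ (-s) := by
      rw [bracket_eq_norm hk]
      exact hφ k hk
    have h2 : |φ k| ≤ ε ^ (1 / t) * bracket k ^ (-s') := by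
      rw [Real.rpow_neg hb.le, ← div_eq_mul_inv, le_div_iff₀ (by positivity)]
      exact hφ' k
    calc |φ k| = |φ k| ^ (1 - t) * |φ k| ^ t := by
          rw [← Real.rpow_add_of_nonneg (abs_nonneg _) (by linarith) ht0.le]
          simp
      _ ≤ (bracket k ^ (-s)) ^ (1 - t) * (ε ^ (1 / t) * bracket k ^ (-s')) ^ t :=
          mul_le_mul (Real.rpow_le_rpow (abs_nonneg _) h1 (by linarith))
            (Real.rpow_le_rpow (abs_nonneg _) h2 ht0.le) (by positivity) (by positivity)
      _ = ε * bracket k ^ (-p) := by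
          rw [Real.mul_rpow (by positivity) (by positivity), ← Real.rpow_mul hε.le,
            one_div_mul_cancel ht0.ne', Real.rpow_one, ← Real.rpow_mul hb.le,
            ← Real.rpow_mul hb.le, mul_left_comm, ← Real.rpow_add hb]
          congr 2
          rw [hp]
          ring

end Hopping

end PowerLaw

end

theorem mainTheorem5 (d : ℕ) (hd : 1 ≤ d) (α₀ δ s : ℝ) (hα₀ : (d : ℝ) / 2 < α₀) (hδ : 0 < δ)
    (hs : α₀ + (Real.logb 2 3 + 1 / 2) * d + 12 * δ < s) :
    ∃ ε₀ : ℝ, 0 < ε₀ ∧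
      ∀ φ : PowerLaw.Site d → ℝ,
        φ 0 = 0 →
        (∀ i : PowerLaw.Site d, i ≠ 0 → |φ i| ≤ ‖i‖ ^ (-s)) →
        PowerLaw.sobolevNorm (s - (d : ℝ) / 2 - δ) (PowerLaw.hopping φ) ≤ ENNReal.ofReal ε₀ →
        (∃ (d' : PowerLaw.Site d → ℝ) (H : PowerLaw.EllTwo d →L[ℂ] PowerLaw.EllTwo d),
          (fun i => (d' i : ℂ)) ∈ PowerLaw.limitPeriodic d ∧
          PowerLaw.IsOperatorOf
            (PowerLaw.hopping φ + Matrix.diagonal (fun i => (d' i : ℂ))) H ∧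
          PowerLaw.IsPowerLawLocalized (s - (Real.logb 2 3 + 1 / 2) * d - 12 * δ) H ∧
          spectrum ℂ H = Complex.ofReal '' Set.Icc (0 : ℝ) 1) ∧
        (∃ (d' : PowerLaw.Site d → ℝ) (H : PowerLaw.EllTwo d →L[ℂ] PowerLaw.EllTwo d),
          (fun i => (d' i : ℂ)) ∈ PowerLaw.limitPeriodic d ∧
          PowerLaw.IsOperatorOf
            (PowerLaw.hopping φ + Matrix.diagonal (fun i => (d' i : ℂ))) H ∧
          PowerLaw.IsPowerLawLocalized (s - (Real.logb 2 3 + 1 / 2) * d - 12 * δ) H ∧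
          ∃ K : Set ℝ, PowerLaw.IsCantorSet K ∧ volume K = 0 ∧
            spectrum ℂ H = Complex.ofReal '' K) := by
  have : NeZero d := ⟨by omega⟩
  have hd0 : (0 : ℝ) < d := by exact_mod_cast hd
  set τ := Real.logb 2 3 * d with hτ
  have hτ0 : 0 ≤ τ := mul_nonneg (Real.logb_nonneg (by norm_num) (by norm_num)) hd0.le
  set r := s - (Real.logb 2 3 + 1 / 2) * d - 12 * δ with hr
  have hrτ : r = s - τ - d / 2 - 12 * δ := by rw [hr, hτ]; ring
  have hsτ : d + τ + 12 * δ < s := by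
    have : (Real.logb 2 3 + 1 / 2) * d = τ + d / 2 := by rw [hτ]; ring
    linarith
  set σ := d + δ with hσ
  have hdσ : (d : ℝ) < σ := by linarith
  set b := max 0 (r - σ) with hb
  have hb0 : 0 ≤ b := le_max_left _ _
  have hbr : r ≤ σ + b := by
    have := le_max_right 0 (r - σ)
    linarith
  have hp : σ + τ + b < s - δ := by
    rcases max_choice 0 (r - σ) with h | h <;> rw [← hb] at h <;> rw [h] <;> linarith
  have hς : (d : ℝ) < σ + b := by linarith
  set Z := ∑' k : PowerLaw.Site d, PowerLaw.bracket k ^ (-(σ + b)) with hZ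
  have hZ0 : 0 ≤ Z := tsum_nonneg fun k => Real.rpow_nonneg (PowerLaw.bracket_pos k).le _
  obtain ⟨κ, hκ0, hκ1, hκZ⟩ : ∃ κ : ℝ, 0 < κ ∧ κ ≤ 1 ∧ κ * Z ≤ 1 / 2 := by
    refine ⟨1 / (2 * (Z + 1)), by positivity, ?_, ?_⟩
    · rw [div_le_one (by positivity)]
      linarith
    · rw [div_mul_eq_mul_div, one_mul, div_le_div_iff₀ (by positivity) (by norm_num)]
      linarith
  obtain ⟨ε₁, hε₁, h₁⟩ := PowerLaw.exists_toeplitz_conjugation (d := d) (c := ((16 : ℝ) ^ d)⁻¹)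
    hdσ hτ0 hb0 hp (by positivity) hκ0
  obtain ⟨ε₂, hε₂, h₂⟩ := PowerLaw.exists_toeplitz_conjugation (d := d) (c := ((3 : ℝ) ^ d)⁻¹)
    hdσ hτ0 hb0 hp (by positivity) hκ0
  set ε := min ε₁ ε₂ with hε
  have hε0 : 0 < ε := lt_min hε₁ hε₂
  set t := δ / (d / 2 + δ) with ht
  have ht0 : 0 < t := by positivity
  have ht1 : t ≤ 1 := by
    rw [ht, div_le_one (by positivity)]
    linarith
  refine ⟨ε ^ (1 / t), by positivity, fun φ h0 hφ hS => ?_⟩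
  have hdecay := PowerLaw.abs_le_of_interpolation (p := s - δ) hε0 ht0 ht1
    (by rw [ht]; field_simp; ring) h0 hφ
    (PowerLaw.abs_le_of_sobolevNorm_le (by positivity) hS)
  have hdec : ∀ ε', ε ≤ ε' → ∀ k, |φ k| ≤ ε' * PowerLaw.bracket k ^ (-(s - δ)) := fun ε' hle k =>
    (hdecay k).trans (mul_le_mul_of_nonneg_right hle
      (Real.rpow_nonneg (PowerLaw.bracket_pos k).le _))
  have hdp : (d : ℝ) < s - δ := by linarith
  constructor
  · have hD := PowerLaw.isDistal_alternating d
    obtain ⟨S, V, Q, hS', hSV, hQ, hQap, hV⟩ := h₁ φ (hdec _ (min_le_left _ _)) _ hD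
    have := PowerLaw.exists_localized_operator hdp hdecay hD.abs_le_one hD.almostPeriodic hS' hSV
      hQ hQap hς hbr hκ1 hκZ hV
    rwa [PowerLaw.closure_range_alternating] at this
  · have hD := PowerLaw.isDistal_cantor d
    obtain ⟨S, V, Q, hS', hSV, hQ, hQap, hV⟩ := h₂ φ (hdec _ (min_le_right _ _)) _ hD
    obtain ⟨d', H, h1, h2, h3, h4⟩ := PowerLaw.exists_localized_operator hdp hdecay hD.abs_le_one
      hD.almostPeriodic hS' hSV hQ hQap hς hbr hκ1 hκZ hV
    rw [PowerLaw.closure_range_cantor] at h4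
    exact ⟨d', H, h1, h2, h3, cantorSet, PowerLaw.isCantorSet_cantorSet,
      PowerLaw.volume_cantorSet, h4⟩
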